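/- **Theorem 6.1.** Let $N\ge 3$, $0\le\mu\le (N-2)^2/8$, $2^*=\frac{2N}{N-2}$, $p=2^*-1$, $K(y)=e^{|y|^2/4}$. Let $L^2_K$ be the space of measurable $u:\mathbb R^N\to\mathbb R$ with $\|u\|_{K,2}^2=\int_{\mathbb R^N}|u|^2K\,dy<\infty$, write $(f,g)_K=\int_{\mathbb R^N} f\cdot g\,K\,dy$, and let $X\hookrightarrow L^2_K$ be the Hilbert space obtained as the completion of $C_c^\infty(\mathbb R^N)$ for the norm $\|\nabla u\|_{K,2}$, with inner product $(\nabla u,\nabla w)_K$. For $v_0\in X$ consider the self-similar equation $$v_s-\Delta v-\tfrac12 y\cdot\nabla v=\frac{v}{p-1}+\frac{\mu v}{|y|^2}+|v|^{p-1}v\ \text{ in }\mathbb R^N\times(0,\infty),\qquad v|_{s=0}=v_0 .$$ A *global (weak) solution* is a function $v$ with $v\in L^\infty(0,\infty;X)$, $v_s\in L^2(0,\infty;L^2_K)$, $v(0)=v_0$ and $$\int_0^s\big[(v_s,w)_K+(\nabla v,\nabla w)_K\big]\,d\tau=\int_0^s\Big(|v|^{p-1}v+\mu\frac{v}{|y|^2}+\frac{v}{p-1},\,w\Big)_K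 d\tau\qquad\text{for all } w\in X,\ s>0,$$ where $v$ denotes the representative that is continuous in $s\ge 0$ with values in $L^2_K$. A *stationary solution* is a $w\in X$ with $$(\nabla w,\nabla\psi)_K=\Big(|w|^{p-1}w+\mu\frac{w}{|y|^2}+\frac{w}{p-1},\,\psi\Big)_K\qquad\text{for all }\psi\in X,$$ the integral on the right converging absolutely. Let $v$ be a global solution that is uniformly bounded in $X$: $\sup_{s\ge 0}\|\nabla v(s)\|_{K,2}<\infty$. Then for every sequence $s_n\to\infty$ there are a subsequence $(s_{n_k})$ and a stationary solution $w\in X$ such that $v(s_{n_k})\rightharpoonup w$ weakly in $X$ as $k\to\infty$. -/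

import Mathlib

open MeasureTheory Filter Topology
open scoped ENNReal ContDiff Gradient

noncomputable section

namespace HardySobolev

/-- The space `ℝ^N` with its Euclidean norm. -/
abbrev Space (N : ℕ) : Type := EuclideanSpace ℝ (Fin N)

/-- The weight `K(y) = exp(|y|² / 4)`. -/
def weight {N : ℕ} (y : Space N) : ℝ := Real.exp (‖y‖ ^ 2 / 4)

/-- The measure `K(y) dy` on `ℝ^N`. -/
def weightMeasure (N : ℕ) : Measure (Space N) :=
  volume.withDensity fun y => ENNReal.ofReal (weight y)

lemma weight_pos {N : ℕ} (y : Space N) : 0 < weight y := Real.exp_pos _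

lemma contDiff_weight {N : ℕ} : ContDiff ℝ ∞ (weight : Space N → ℝ) := by
  unfold weight
  exact ((contDiff_norm_sq ℝ).div_const _).exp

instance (N : ℕ) : IsLocallyFiniteMeasure (weightMeasure N) :=
  IsLocallyFiniteMeasure.withDensity_ofReal contDiff_weight.continuous

lemma integral_weightMeasure {N : ℕ} (f : Space N → ℝ) :
    ∫ y, f y ∂(weightMeasure N) = ∫ y, weight y * f y := by
  unfold weightMeasure
  rw [integral_withDensity_eq_integral_toReal_smul
    (contDiff_weight.continuous.measurable.ennreal_ofReal) (by simp)]
  simp [ENNReal.toReal_ofReal (weight_pos _).le]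

/-- The weighted Lebesgue space `L²_K(ℝ^N)`. -/
abbrev L2K (N : ℕ) : Type := Lp ℝ 2 (weightMeasure N)

/-- The space `C_c^∞(ℝ^N)`, as a linear subspace of all functions. -/
def testSubmodule (N : ℕ) : Submodule ℝ (Space N → ℝ) where
  carrier := {φ | ContDiff ℝ ∞ φ ∧ HasCompactSupport φ}
  add_mem' h₁ h₂ := ⟨h₁.1.add h₂.1, h₁.2.add h₂.2⟩
  zero_mem' := ⟨contDiff_const, HasCompactSupport.zero⟩
  smul_mem' c _ h := ⟨contDiff_const.smul h.1, h.2.smul_left (f := fun _ => c)⟩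

/-- The space `C_c^∞(ℝ^N)`; below it carries the norm `‖∇φ‖_{K,2}`. -/
def TestFn (N : ℕ) : Type := testSubmodule N

namespace TestFn

variable {N : ℕ}

instance : AddCommGroup (TestFn N) := inferInstanceAs (AddCommGroup (testSubmodule N))

instance : Module ℝ (TestFn N) := inferInstanceAs (Module ℝ (testSubmodule N))

/-- The underlying function of a test function. -/
def fn (φ : TestFn N) : Space N → ℝ := φ.1

lemma contDiff (φ : TestFn N) : ContDiff ℝ ∞ φ.fn := φ.2.1

lemma hasCompactSupport (φ : TestFn N) : HasCompactSupport φ.fn := φ.2.2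

lemma differentiable (φ : TestFn N) : Differentiable ℝ φ.fn := φ.contDiff.differentiable (by simp)

lemma continuous_gradient (φ : TestFn N) : Continuous (∇ φ.fn) :=
  (InnerProductSpace.toDual ℝ (Space N)).symm.continuous.comp
    (φ.contDiff.continuous_fderiv (by simp))

lemma hasCompactSupport_gradient (φ : TestFn N) : HasCompactSupport (∇ φ.fn) :=
  (φ.hasCompactSupport.fderiv (𝕜 := ℝ)).comp_left
    (g := (InnerProductSpace.toDual ℝ (Space N)).symm) (map_zero _)

lemma gradient_add (φ ψ : TestFn N) : ∇ (φ + ψ).fn = ∇ φ.fn + ∇ ψ.fn := by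
  funext y
  change (InnerProductSpace.toDual ℝ (Space N)).symm (fderiv ℝ (φ.fn + ψ.fn) y) = _
  rw [fderiv_add φ.differentiable.differentiableAt ψ.differentiable.differentiableAt, map_add]
  rfl

lemma gradient_smul (c : ℝ) (φ : TestFn N) : ∇ (c • φ).fn = c • ∇ φ.fn := by
  funext y
  change (InnerProductSpace.toDual ℝ (Space N)).symm (fderiv ℝ (c • φ.fn) y) = _
  rw [fderiv_const_smul φ.differentiable.differentiableAt, map_smulₛₗ]
  rfl

lemma memLp_fn (φ : TestFn N) : MemLp φ.fn 2 (weightMeasure N) :=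
  φ.contDiff.continuous.memLp_of_hasCompactSupport φ.hasCompactSupport

lemma memLp_gradient (φ : TestFn N) : MemLp (∇ φ.fn) 2 (weightMeasure N) :=
  φ.continuous_gradient.memLp_of_hasCompactSupport φ.hasCompactSupport_gradient

/-- The class of a test function in `L²_K(ℝ^N)`. -/
def toL2 (N : ℕ) : TestFn N →ₗ[ℝ] L2K N where
  toFun φ := φ.memLp_fn.toLp φ.fn
  map_add' φ ψ := MemLp.toLp_add φ.memLp_fn ψ.memLp_fn
  map_smul' c φ := MemLp.toLp_const_smul c φ.memLp_fn

/-- The gradient of a test function, as an element of `L²_K(ℝ^N; ℝ^N)`. -/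
def grad (N : ℕ) : TestFn N →ₗ[ℝ] Lp (Space N) 2 (weightMeasure N) where
  toFun φ := φ.memLp_gradient.toLp (∇ φ.fn)
  map_add' φ ψ := by
    rw [← MemLp.toLp_add φ.memLp_gradient ψ.memLp_gradient]
    exact MemLp.toLp_congr _ _ (by rw [gradient_add])
  map_smul' c φ := by
    rw [RingHom.id_apply, ← MemLp.toLp_const_smul c φ.memLp_gradient]
    exact MemLp.toLp_congr _ _ (by rw [gradient_smul])

/-- `‖φ‖ = ‖∇φ‖_{K,2}`. -/
instance : SeminormedAddCommGroup (TestFn N) := SeminormedAddCommGroup.induced _ _ (grad N)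

/-- `(φ, ψ)_K = ∫ ∇φ · ∇ψ K dy`. -/
instance : InnerProductSpace ℝ (TestFn N) where
  norm_smul_le c φ := by
    change ‖grad N (c • φ)‖ ≤ ‖c‖ * ‖grad N φ‖
    rw [map_smul, norm_smul]
  inner φ ψ := inner ℝ (grad N φ) (grad N ψ)
  norm_sq_eq_re_inner φ := norm_sq_eq_re_inner (grad N φ)
  conj_inner_symm φ ψ := inner_conj_symm (grad N φ) (grad N ψ)
  add_left φ ψ χ := by rw [map_add]; exact inner_add_left _ _ _
  smul_left φ ψ c := by rw [map_smul]; exact inner_smul_left _ _ _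

lemma inner_eq (φ ψ : TestFn N) :
    inner ℝ φ ψ = ∫ y, weight y * inner ℝ (∇ φ.fn y) (∇ ψ.fn y) := by
  rw [← integral_weightMeasure]
  change inner ℝ (grad N φ) (grad N ψ) = _
  rw [L2.inner_def]
  refine integral_congr_ae ?_
  filter_upwards [φ.memLp_gradient.coeFn_toLp, ψ.memLp_gradient.coeFn_toLp] with y h₁ h₂
  change inner ℝ (φ.memLp_gradient.toLp _ y) (ψ.memLp_gradient.toLp _ y) = _
  rw [h₁, h₂]

lemma norm_sq_eq (φ : TestFn N) : ‖φ‖ ^ 2 = ∫ y, weight y * ‖∇ φ.fn y‖ ^ 2 := by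
  rw [← real_inner_self_eq_norm_sq, inner_eq]
  simp only [real_inner_self_eq_norm_sq]

lemma norm_toL2_sq_eq (φ : TestFn N) : ‖toL2 N φ‖ ^ 2 = ∫ y, weight y * φ.fn y ^ 2 := by
  rw [← real_inner_self_eq_norm_sq, ← integral_weightMeasure, L2.inner_def]
  refine integral_congr_ae ?_
  filter_upwards [φ.memLp_fn.coeFn_toLp] with y h₁
  change inner ℝ (φ.memLp_fn.toLp _ y) (φ.memLp_fn.toLp _ y) = _
  rw [h₁, real_inner_self_eq_norm_sq, Real.norm_eq_abs, sq_abs]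

/-- Integration by parts against the radial field. -/
lemma integral_radial (φ : TestFn N) :
    ∫ y, fderiv ℝ (fun z => weight z * φ.fn z ^ 2) y y = - (N * ∫ y, weight y * φ.fn y ^ 2) := by
  set f : Space N → ℝ := fun z => weight z * φ.fn z ^ 2 with hf
  have hfs : ContDiff ℝ ∞ f := contDiff_weight.mul (φ.contDiff.pow 2)
  have hfc : HasCompactSupport f :=
    (φ.hasCompactSupport.comp_left (g := fun t : ℝ => t ^ 2) (by simp)).mul_left
  have hfd : Continuous (fderiv ℝ f) := hfs.continuous_fderiv (by simp)
  have hfdc : HasCompactSupport (fderiv ℝ f) := hfc.fderiv (𝕜 := ℝ)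
  have hint : Integrable f := hfs.continuous.integrable_of_hasCompactSupport hfc
  let e : Fin N → Space N := fun i => EuclideanSpace.single i 1
  have hdi : ∀ (i : Fin N) (y : Space N),
      fderiv ℝ (fun z : Space N => z i) y (e i) = 1 := by
    intro i y
    have : (fun z : Space N => z i) = (EuclideanSpace.proj i : Space N →L[ℝ] ℝ) := rfl
    rw [this, ContinuousLinearMap.fderiv]
    simp [e]
  have hi2 : ∀ i : Fin N, Integrable (fun y : Space N => fderiv ℝ f y (e i) * y i) := by
    intro i
    apply Continuous.integrable_of_hasCompactSupport
    · fun_prop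
    · exact (hfdc.comp_left (g := fun L : Space N →L[ℝ] ℝ => L (e i)) (by simp)).mul_right
  have hparts : ∀ i : Fin N, ∫ y, f y = - ∫ y, fderiv ℝ f y (e i) * y i := by
    intro i
    have h := integral_mul_fderiv_eq_neg_fderiv_mul_of_integrable (μ := (volume : Measure (Space N)))
      (f := f) (g := fun z : Space N => z i) (v := e i) (hi2 i)
      (by simpa only [hdi, mul_one] using hint)
      (by
        apply Continuous.integrable_of_hasCompactSupport
        · exact hfs.continuous.mul (by fun_prop)
        · exact hfc.mul_right)
      (fun y _ => hfs.differentiable (by simp) y)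
      (fun y _ => (EuclideanSpace.proj i : Space N →L[ℝ] ℝ).differentiableAt)
    simpa only [hdi, mul_one] using h
  have hsum : ∀ y : Space N, fderiv ℝ f y y = ∑ i, fderiv ℝ f y (e i) * y i := by
    intro y
    have hy : y = ∑ i, y i • e i := by
      ext j
      simp [e, Pi.single_apply]
    conv_lhs => rw [hy]
    rw [map_sum]
    refine Finset.sum_congr rfl fun i _ => ?_
    rw [map_smul, smul_eq_mul, mul_comm, ← hy]
  simp only [hsum]
  rw [integral_finsetSum _ fun i _ => hi2 i]
  have : ∀ i : Fin N, ∫ y, fderiv ℝ f y (e i) * y i = - ∫ y, f y := fun i => by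
    rw [hparts i, neg_neg]
  simp [this]

lemma hasFDerivAt_weight (y : Space N) :
    HasFDerivAt (weight : Space N → ℝ) ((weight y / 2) • innerSL ℝ y) y := by
  have h := (((hasStrictFDerivAt_norm_sq y).hasFDerivAt).mul_const (1 / 4 : ℝ)).exp
  have hw : (weight : Space N → ℝ) = fun z => Real.exp (‖z‖ ^ 2 * (1 / 4)) := by
    funext z
    rw [weight, div_eq_mul_one_div]
  rw [hw]
  refine h.congr_fderiv ?_
  ext z
  simp
  ring

lemma fderiv_radial (φ : TestFn N) (y : Space N) :
    fderiv ℝ (fun z => weight z * φ.fn z ^ 2) y y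
      = weight y * (2 * φ.fn y * inner ℝ (∇ φ.fn y) y + φ.fn y ^ 2 * (‖y‖ ^ 2 / 2)) := by
  have h₂ : HasFDerivAt φ.fn (fderiv ℝ φ.fn y) y := φ.differentiable.differentiableAt.hasFDerivAt
  have hg : inner ℝ (∇ φ.fn y) y = fderiv ℝ φ.fn y y := by
    simp [gradient]
  have hy : (innerSL ℝ y) y = ‖y‖ ^ 2 := real_inner_self_eq_norm_sq y
  simp only [sq (φ.fn _)]
  rw [((hasFDerivAt_weight y).fun_mul (h₂.fun_mul h₂)).fderiv, hg]
  simp only [add_apply, smul_apply, hy, smul_eq_mul]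
  ring

lemma integrable_sq (φ : TestFn N) : Integrable fun y => weight y * φ.fn y ^ 2 := by
  have s₁ : HasCompactSupport fun y => φ.fn y ^ 2 :=
    φ.hasCompactSupport.comp_left (g := fun t : ℝ => t ^ 2) (by simp)
  exact (contDiff_weight.continuous.mul
    (φ.contDiff.continuous.pow 2)).integrable_of_hasCompactSupport s₁.mul_left

lemma integrable_gradient_sq (φ : TestFn N) :
    Integrable fun y => weight y * ‖∇ φ.fn y‖ ^ 2 := by
  have s₁ : HasCompactSupport fun y => ‖∇ φ.fn y‖ ^ 2 :=
    φ.hasCompactSupport_gradient.comp_left (g := fun t : Space N => ‖t‖ ^ 2) (by simp)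
  exact (contDiff_weight.continuous.mul
    (φ.continuous_gradient.norm.pow 2)).integrable_of_hasCompactSupport s₁.mul_left

lemma integrable_radial (φ : TestFn N) : Integrable fun y : Space N =>
    weight y * (2 * φ.fn y * inner ℝ (∇ φ.fn y) y + φ.fn y ^ 2 * (‖y‖ ^ 2 / 2)) := by
  have c₀ := (contDiff_weight (N := N)).continuous
  have c₁ := φ.contDiff.continuous
  have c₂ : Continuous fun y : Space N => inner ℝ (∇ φ.fn y) y :=
    φ.continuous_gradient.inner continuous_id
  have s₁ : HasCompactSupport fun y => φ.fn y ^ 2 :=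
    φ.hasCompactSupport.comp_left (g := fun t : ℝ => t ^ 2) (by simp)
  have s₂ : HasCompactSupport fun y => 2 * φ.fn y :=
    φ.hasCompactSupport.comp_left (g := fun t : ℝ => 2 * t) (by simp)
  have s₃ : HasCompactSupport fun y : Space N =>
      2 * φ.fn y * inner ℝ (∇ φ.fn y) y + φ.fn y ^ 2 * (‖y‖ ^ 2 / 2) :=
    s₂.mul_right.add s₁.mul_right
  refine Continuous.integrable_of_hasCompactSupport ?_ s₃.mul_left
  exact c₀.mul (((continuous_const.mul c₁).mul c₂).add
    ((c₁.pow 2).mul ((continuous_norm.pow 2).div_const 2)))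

/-- The Poincaré inequality `(N/2) ‖φ‖²_{K,2} ≤ ‖∇φ‖²_{K,2}`. -/
lemma poincare (φ : TestFn N) : (N : ℝ) / 2 * ‖toL2 N φ‖ ^ 2 ≤ ‖φ‖ ^ 2 := by
  rw [norm_sq_eq, norm_toL2_sq_eq]
  have hr := φ.integral_radial
  rw [integral_congr_ae (Eventually.of_forall φ.fderiv_radial)] at hr
  have hpt : ∀ y : Space N, 0 ≤ weight y * ‖∇ φ.fn y‖ ^ 2
      + (1 / 2) * (weight y * (2 * φ.fn y * inner ℝ (∇ φ.fn y) y
        + φ.fn y ^ 2 * (‖y‖ ^ 2 / 2))) := by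
    intro y
    have h : 0 ≤ ‖∇ φ.fn y + (φ.fn y / 2) • y‖ ^ 2 := sq_nonneg _
    rw [norm_add_sq_real, inner_smul_right, norm_smul, mul_pow, Real.norm_eq_abs, sq_abs] at h
    have h' := mul_nonneg (weight_pos y).le h
    refine h'.trans_eq ?_
    ring
  have hle := integral_nonneg (μ := (volume : Measure (Space N))) (Pi.le_def.2 hpt)
  rw [integral_add φ.integrable_gradient_sq (φ.integrable_radial.const_mul _),
    integral_const_mul, hr] at hle
  linarith

/-- The inclusion `C_c^∞(ℝ^N) → L²_K(ℝ^N)`, continuous for the norm `‖∇φ‖_{K,2}`. -/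
def toL2CLM (N : ℕ) [hN : Fact (3 ≤ N)] : TestFn N →L[ℝ] L2K N :=
  (toL2 N).mkContinuous 1 fun φ => by
    have h := φ.poincare
    have h3 : (3 : ℝ) ≤ N := by exact_mod_cast hN.out
    rw [one_mul]
    refine le_of_sq_le_sq ?_ (norm_nonneg _)
    nlinarith [sq_nonneg ‖toL2 N φ‖]

end TestFn

/-- The Hilbert space `X`: the completion of `C_c^∞(ℝ^N)` for the norm `‖∇φ‖_{K,2}`. Its inner
product is the extension of `(φ, ψ)_K = ∫ ∇φ · ∇ψ K dy`. -/
abbrev X (N : ℕ) : Type := UniformSpace.Completion (TestFn N)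

section

variable {N : ℕ} [Fact (3 ≤ N)]

/-- The embedding `X → L²_K(ℝ^N)`, through which the elements of `X` are functions on `ℝ^N`. -/
def emb (N : ℕ) [Fact (3 ≤ N)] : X N →L[ℝ] L2K N :=
  (TestFn.toL2CLM N).extend (UniformSpace.Completion.toComplL (𝕜 := ℝ) (E := TestFn N))

lemma emb_coe (φ : TestFn N) : emb N (φ : X N) = TestFn.toL2 N φ :=
  ContinuousLinearMap.extend_eq _ UniformSpace.Completion.denseRange_coe
    (UniformSpace.Completion.isUniformInducing_coe _) φ

/-- The exponent `p = 2* - 1`, where `2* = 2N / (N - 2)`. -/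
def pExp (N : ℕ) : ℝ := 2 * N / (N - 2) - 1

/-- The function `|u|^(p-1) u + μ u / |y|² + u / (p-1)` on `ℝ^N`. -/
def source (μ : ℝ) (u : Space N → ℝ) (y : Space N) : ℝ :=
  |u y| ^ (pExp N - 1) * u y + μ * u y / ‖y‖ ^ 2 + u y / (pExp N - 1)

/-- The integrand of the pairing `(|u|^(p-1) u + μ u / |y|² + u / (p-1), w)_K`
with respect to the measure `K dy`. -/
def sourceMul (μ : ℝ) (u w : X N) (y : Space N) : ℝ := source μ (emb N u) y * emb N w y

/-- The pairing `(|u|^(p-1) u + μ u / |y|² + u / (p-1), w)_K`. -/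
def sourcePairing (μ : ℝ) (u w : X N) : ℝ := ∫ y, sourceMul μ u w y ∂(weightMeasure N)

/-- The open time interval `(0, S)`, where `S = ⊤` is allowed. -/
def timeInterval (S : EReal) : Set ℝ := {s | 0 < s ∧ (s : EReal) < S}

/-- `v` is a weak solution on `ℝ^N × (0, S)`, with initial value `v₀`, of
`v_s - Δv - (1/2) y · ∇v = v / (p-1) + μ v / |y|² + |v|^(p-1) v`:
`v ∈ L^∞(0, S; X)`, `v_s = g ∈ L²(0, S; L²_K)`, and the weak form holds against every `w ∈ X`
on every `(0, s) ⊆ (0, S)`. That `g` is the time derivative `v_s` and that `v(0) = v₀`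
is expressed by `v(s) = v₀ + ∫₀ˢ g` in `L²_K`, so that `v` is the representative which is
continuous in time with values in `L²_K`. -/
structure IsWeakSolution (μ : ℝ) (S : EReal) (v₀ : X N) (v : ℝ → X N) : Prop where
  memLp : MemLp v ∞ (volume.restrict (timeInterval S))
  initial : v 0 = v₀
  exists_deriv : ∃ g : ℝ → L2K N,
    MemLp g 2 (volume.restrict (timeInterval S)) ∧
    (∀ s ∈ timeInterval S, emb N (v s) = emb N v₀ + ∫ τ in (0 : ℝ)..s, g τ) ∧
    ∀ w : X N, ∀ s ∈ timeInterval S,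
      ∫ τ in (0 : ℝ)..s, (inner ℝ (g τ) (emb N w) + inner ℝ (v τ) w)
        = ∫ τ in (0 : ℝ)..s, sourcePairing μ (v τ) w

/-- A global solution: a weak solution on `ℝ^N × (0, ∞)`. -/
def IsGlobalSolution (μ : ℝ) (v₀ : X N) (v : ℝ → X N) : Prop := IsWeakSolution μ ⊤ v₀ v

/-- `w ∈ X` is a stationary (weak) solution:
`-Δw - (1/2) y · ∇w = w / (p-1) + μ w / |y|² + |w|^(p-1) w` when tested in `X`. -/
def IsStationarySolution (μ : ℝ) (w : X N) : Prop :=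
  ∀ ψ : X N, Integrable (sourceMul μ w ψ) (weightMeasure N) ∧
    inner ℝ w ψ = sourcePairing μ w ψ

end

end HardySobolev

end

open HardySobolev

open HardySobolev

/-! The argument needs no energy functional: it rests on `v_s` being square integrable over the
infinite time interval, so that its integral over `[a, a + 1]` tends to zero in `L²_K` as `a → ∞`. A
bounded sequence `v(s_n)` has a weak limit `w` along a subsequence. Fix a test function `φ` and call
`sourcePairing μ (v τ) φ - ⟨v τ, φ⟩` the residual at time `τ`. Integrating the equation over `[s_n,
s_n + 1]` shows that the average of the residual is the integral of `(v_s, φ)_K`, hence small. The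
residual is continuous in time, so it attains this average at some `t_n` (`exists_abs_residual_le`).
Moreover `v(t_n) - v(s_n) → 0` in `L²_K`, so `v(t_n)` has the same weak limit `w` in `X`
(`weakTendsto_of_emb`). Passing to the limit in the residual gives the stationary equation for `w`
tested with `φ`, and density extends it to all of `X`.

The limit passage is `tendsto_sourcePairing`. The linear and Hardy terms are weakly continuous
because `emb` and `hardyCLM` are bounded operators. The embedding into `L^{2*}` need not be compact,
but against a bounded `φ` only the power `p = 2* - 1` of `v` is integrated. The bound in `L^{2*}`
then gives uniform integrability, and almost everywhere convergence (`exists_subseq_ae_tendsto`)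
suffices. -/

noncomputable section

/-! ### Weak convergence in Hilbert spaces. -/

section WeakConvergence

variable {E : Type*} [NormedAddCommGroup E] [InnerProductSpace ℝ E]

/-- Weak convergence of a sequence in a real inner product space. -/
def WeakTendsto (u : ℕ → E) (w : E) : Prop :=
  ∀ ψ : E, Tendsto (fun n => inner ℝ (u n) ψ) atTop (𝓝 (inner ℝ w ψ))

lemma WeakTendsto.comp {u : ℕ → E} {w : E} (h : WeakTendsto u w) {k : ℕ → ℕ}
    (hk : Tendsto k atTop atTop) : WeakTendsto (fun n => u (k n)) w :=
  fun ψ => (h ψ).comp hk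

lemma WeakTendsto.map [CompleteSpace E] {F : Type*} [NormedAddCommGroup F]
    [InnerProductSpace ℝ F] [CompleteSpace F] {u : ℕ → E} {w : E} (h : WeakTendsto u w)
    (A : E →L[ℝ] F) : WeakTendsto (fun n => A (u n)) (A w) := by
  intro ψ
  simpa only [ContinuousLinearMap.adjoint_inner_right] using h (A.adjoint ψ)

lemma WeakTendsto.toWeakSpace [CompleteSpace E] {u : ℕ → E} {w : E} (h : WeakTendsto u w) :
    Tendsto (fun n => toWeakSpace ℝ E (u n)) atTop (𝓝 (toWeakSpace ℝ E w)) := by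
  have hinj : Function.Injective (topDualPairing ℝ E).flip := by
    intro x y hxy
    refine ext_inner_left ℝ fun z => ?_
    exact congrArg (fun f => f (innerSL ℝ z)) hxy
  refine (WeakBilin.tendsto_iff_forall_eval_tendsto _ hinj).2 fun f => ?_
  have := h ((InnerProductSpace.toDual ℝ E).symm f)
  simp only [real_inner_comm ((InnerProductSpace.toDual ℝ E).symm f),
    InnerProductSpace.toDual_symm_apply] at this
  exact this

/-- Weak convergence of a bounded sequence can be tested on a dense set. -/
lemma weakTendsto_of_dense {u : ℕ → E} {w : E} {C : ℝ} (hC : ∀ᶠ n in atTop, ‖u n‖ ≤ C)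
    {D : Set E} (hD : Dense D)
    (h : ∀ ψ ∈ D, Tendsto (fun n => inner ℝ (u n) ψ) atTop (𝓝 (inner ℝ w ψ))) :
    WeakTendsto u w := by
  intro ψ
  rw [Metric.tendsto_nhds]
  intro ε hε
  set B : ℝ := |C| + ‖w‖ + 1 with hB
  have hBpos : 0 < B := by positivity
  obtain ⟨φ, hφD, hφ⟩ := hD.exists_dist_lt ψ (show 0 < ε / (2 * B) by positivity)
  filter_upwards [hC, Metric.tendsto_nhds.1 (h φ hφD) (ε / 2) (by positivity)] with n h₁ h₂
  rw [Real.dist_eq] at h₂ ⊢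
  have e : (inner ℝ (u n) ψ - inner ℝ w ψ : ℝ)
      = (inner ℝ (u n) φ - inner ℝ w φ) + inner ℝ (u n - w) (ψ - φ) := by
    simp only [inner_sub_left, inner_sub_right]
    ring
  have h₃ : |inner ℝ (u n - w) (ψ - φ)| ≤ B * (ε / (2 * B)) := by
    refine (abs_real_inner_le_norm _ _).trans (mul_le_mul ?_ ?_ (norm_nonneg _) hBpos.le)
    · have := norm_sub_le (u n) w
      have := le_abs_self C
      linarith
    · rw [← dist_eq_norm]
      exact hφ.le
  have h₄ : B * (ε / (2 * B)) = ε / 2 := by field_simp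
  rw [e]
  calc _ ≤ _ := abs_add_le _ _
    _ < ε / 2 + ε / 2 := by linarith
    _ = ε := by ring

/-- A bounded sequence in a Hilbert space has a weakly convergent subsequence. -/
lemma exists_weakTendsto_subseq [CompleteSpace E] {u : ℕ → E} {C : ℝ} (hC : ∀ n, ‖u n‖ ≤ C) :
    ∃ (k : ℕ → ℕ) (w : E), StrictMono k ∧ WeakTendsto (fun n => u (k n)) w := by
  -- Sequential Banach–Alaoglu requires separability, so the argument takes place in the closed span
  -- of the sequence.
  set S : Submodule ℝ E := (Submodule.span ℝ (Set.range u)).topologicalClosure with hS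
  have hmem : ∀ n, u n ∈ S := fun n =>
    Submodule.le_topologicalClosure _ (Submodule.subset_span ⟨n, rfl⟩)
  have hsep : TopologicalSpace.SeparableSpace S := by
    have h1 : TopologicalSpace.IsSeparable (Set.range u) := (Set.countable_range u).isSeparable
    have h2 := (h1.span (R := ℝ)).closure
    exact h2.separableSpace
  have : CompleteSpace S := (Submodule.isClosed_topologicalClosure _).completeSpace_coe
  let f : ℕ → WeakDual ℝ S := fun n =>
    StrongDual.toWeakDual (InnerProductSpace.toDual ℝ S ⟨u n, hmem n⟩)
  have hf : ∀ n, f n ∈ WeakDual.toStrongDual ⁻¹' Metric.closedBall (0 : StrongDual ℝ S) C := by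
    intro n
    change dist (InnerProductSpace.toDual ℝ S ⟨u n, hmem n⟩) 0 ≤ C
    refine (dist_zero_right (InnerProductSpace.toDual ℝ S ⟨u n, hmem n⟩)).trans_le ?_
    exact ((InnerProductSpace.toDual ℝ S).norm_map ⟨u n, hmem n⟩).trans_le (hC n)
  obtain ⟨g, -, k, hk, hlim⟩ := WeakDual.isSeqCompact_closedBall ℝ S (0 : StrongDual ℝ S) C hf
  let w : S := (InnerProductSpace.toDual ℝ S).symm (WeakDual.toStrongDual g)
  refine ⟨k, w, hk, fun ψ => ?_⟩
  -- Pairings of elements of `S` with `ψ` only see the projection of `ψ`, so the weak limit in `S`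
  -- is a weak limit in `E`.
  have h1 : ∀ x : S, inner ℝ (x : E) ψ = inner ℝ x (S.orthogonalProjectionOnto ψ) := by
    intro x
    simp
  have h2 := (WeakDual.eval_continuous (S.orthogonalProjectionOnto ψ)).tendsto g |>.comp hlim
  have h3 : inner ℝ (w : E) ψ = g (S.orthogonalProjectionOnto ψ) := by
    rw [h1, InnerProductSpace.toDual_symm_apply]; rfl
  rw [h3]
  refine h2.congr fun n => ?_
  rw [show inner ℝ (u (k n)) ψ = _ from h1 ⟨u (k n), hmem _⟩]
  rfl

end WeakConvergence

namespace HardySobolev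

/-! ### From convergence in `L²_K` to weak convergence in `X`. -/

section IntegrationByParts

variable {N : ℕ}

lemma inner_gradient_eq (φ : TestFn N) (y z : Space N) :
    inner ℝ (∇ φ.fn y) z = fderiv ℝ φ.fn y z := by
  simp [gradient]

lemma gradient_apply (φ : TestFn N) (y : Space N) (i : Fin N) :
    ∇ φ.fn y i = fderiv ℝ φ.fn y (EuclideanSpace.single i 1) := by
  rw [← inner_gradient_eq, EuclideanSpace.inner_single_right]
  simp

/-- Integration by parts: the inner product of `X` against a test function is continuous
for the `L²_K` topology. -/
lemma exists_inner_eq_inner_toL2 (φ : TestFn N) :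
    ∃ ℓ : L2K N, ∀ χ : TestFn N, inner ℝ χ φ = inner ℝ (TestFn.toL2 N χ) ℓ := by
  let e : Fin N → Space N := fun i => EuclideanSpace.single i 1
  let g : Fin N → Space N → ℝ := fun i y => weight y * fderiv ℝ φ.fn y (e i)
  have hg : ∀ i, ContDiff ℝ ∞ (g i) := fun i =>
    contDiff_weight.mul ((φ.contDiff.fderiv_right (m := ∞) (by simp)).clm_apply contDiff_const)
  have hgc : ∀ i, HasCompactSupport (g i) := fun i =>
    ((φ.hasCompactSupport.fderiv (𝕜 := ℝ)).comp_left
      (g := fun L : Space N →L[ℝ] ℝ => L (e i)) (by simp)).mul_left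
  have hdg : ∀ i, Continuous fun y => fderiv ℝ (g i) y (e i) := fun i =>
    ((hg i).continuous_fderiv (by simp)).clm_apply continuous_const
  have hdgc : ∀ i, HasCompactSupport fun y => fderiv ℝ (g i) y (e i) := fun i =>
    ((hgc i).fderiv (𝕜 := ℝ)).comp_left (g := fun L : Space N →L[ℝ] ℝ => L (e i)) (by simp)
  -- This is `-K⁻¹ div(K ∇φ)`, the weighted operator applied to `φ`; it is continuous with compact
  -- support, hence in `L²_K`.
  let l : Space N → ℝ := fun y => -∑ i, (weight y)⁻¹ * fderiv ℝ (g i) y (e i)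
  have hl : Continuous l := (continuous_finsetSum _ fun i _ =>
    (contDiff_weight.continuous.inv₀ fun y => (weight_pos y).ne').mul (hdg i)).neg
  have hlc : HasCompactSupport l := by
    refine HasCompactSupport.neg ?_
    refine HasCompactSupport.intro (K := ⋃ i, tsupport fun y => fderiv ℝ (g i) y (e i))
      (isCompact_iUnion fun i => hdgc i) fun y hy => ?_
    refine Finset.sum_eq_zero fun i _ => ?_
    rw [image_eq_zero_of_notMem_tsupport (f := fun y => fderiv ℝ (g i) y (e i))
      fun h => hy (Set.mem_iUnion.2 ⟨i, h⟩), mul_zero]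
  have hlm : MemLp l 2 (weightMeasure N) := hl.memLp_of_hasCompactSupport hlc
  refine ⟨hlm.toLp l, fun χ => ?_⟩
  have hdχ : ∀ i, Continuous fun y => fderiv ℝ χ.fn y (e i) := fun i =>
    (χ.contDiff.continuous_fderiv (by simp)).clm_apply continuous_const
  have i₁ : ∀ i, Integrable fun y => fderiv ℝ χ.fn y (e i) * g i y := fun i =>
    ((hdχ i).mul (hg i).continuous).integrable_of_hasCompactSupport (hgc i).mul_left
  have i₂ : ∀ i, Integrable fun y => χ.fn y * fderiv ℝ (g i) y (e i) := fun i =>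
    (χ.contDiff.continuous.mul (hdg i)).integrable_of_hasCompactSupport (hdgc i).mul_left
  have i₃ : ∀ i, Integrable fun y => χ.fn y * g i y := fun i =>
    (χ.contDiff.continuous.mul (hg i).continuous).integrable_of_hasCompactSupport (hgc i).mul_left
  have hp : ∀ i, ∫ y, χ.fn y * fderiv ℝ (g i) y (e i) = -∫ y, fderiv ℝ χ.fn y (e i) * g i y :=
    fun i => integral_mul_fderiv_eq_neg_fderiv_mul_of_integrable (i₁ i) (i₂ i) (i₃ i)
      (fun y _ => χ.differentiable y) (fun y _ => (hg i).differentiable (by simp) y)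
  have hinner : ∀ y, weight y * inner ℝ (∇ χ.fn y) (∇ φ.fn y)
      = ∑ i, fderiv ℝ χ.fn y (e i) * g i y := by
    intro y
    rw [PiLp.inner_apply, Finset.mul_sum]
    refine Finset.sum_congr rfl fun i _ => ?_
    rw [gradient_apply, gradient_apply]
    simp only [g, e, RCLike.inner_apply, conj_trivial]
    ring
  rw [TestFn.inner_eq, L2.inner_def]
  have hr : ∫ y, inner ℝ (TestFn.toL2 N χ y) (hlm.toLp l y) ∂(weightMeasure N)
      = ∫ y, χ.fn y * l y ∂(weightMeasure N) := by
    refine integral_congr_ae ?_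
    filter_upwards [χ.memLp_fn.coeFn_toLp, hlm.coeFn_toLp] with y h₁ h₂
    change inner ℝ (χ.memLp_fn.toLp _ y) _ = _
    rw [h₁, h₂, RCLike.inner_apply, conj_trivial, mul_comm]
  rw [hr, integral_weightMeasure]
  have hr' : ∀ y, weight y * (χ.fn y * l y) = -∑ i, χ.fn y * fderiv ℝ (g i) y (e i) := by
    intro y
    simp only [l, mul_neg, Finset.mul_sum]
    refine congrArg _ (Finset.sum_congr rfl fun i _ => ?_)
    have := (weight_pos y).ne'
    field_simp
  simp only [hr', hinner]
  rw [integral_neg, integral_finsetSum _ fun i _ => i₁ i, integral_finsetSum _ fun i _ => i₂ i,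
    ← Finset.sum_neg_distrib]
  exact Finset.sum_congr rfl fun i _ => by rw [hp, neg_neg]

variable [Fact (3 ≤ N)]

lemma exists_inner_eq_inner_emb (φ : TestFn N) :
    ∃ ℓ : L2K N, ∀ u : X N, inner ℝ u (φ : X N) = inner ℝ (emb N u) ℓ := by
  obtain ⟨ℓ, hℓ⟩ := exists_inner_eq_inner_toL2 φ
  refine ⟨ℓ, fun u => ?_⟩
  induction u using UniformSpace.Completion.induction_on with
  | hp => exact isClosed_eq (by fun_prop) (by fun_prop)
  | ih χ => rw [UniformSpace.Completion.inner_coe, emb_coe, hℓ]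

/-- A bounded sequence of `X` that converges in `L²_K` converges weakly in `X`. -/
lemma weakTendsto_of_emb {u : ℕ → X N} {w : X N} {C : ℝ} (hC : ∀ᶠ n in atTop, ‖u n‖ ≤ C)
    (h : WeakTendsto (fun n => emb N (u n)) (emb N w)) : WeakTendsto u w := by
  refine weakTendsto_of_dense hC UniformSpace.Completion.denseRange_coe ?_
  rintro _ ⟨φ, rfl⟩
  obtain ⟨ℓ, hℓ⟩ := exists_inner_eq_inner_emb φ
  simpa only [hℓ] using h ℓ

end IntegrationByParts

/-! ### The weighted Hardy inequality. -/

section Hardy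

variable {N : ℕ}

/-- The function `(|y|² + ε)^(-1/2)`. -/
def regInvNorm (ε : ℝ) (y : Space N) : ℝ := (√(‖y‖ ^ 2 + ε))⁻¹

lemma contDiff_regInvNorm {ε : ℝ} (hε : 0 < ε) :
    ContDiff ℝ ∞ (regInvNorm ε : Space N → ℝ) := by
  refine ContDiff.inv (ContDiff.sqrt ?_ fun y => by positivity) fun y => by positivity
  exact (contDiff_norm_sq ℝ).add contDiff_const

lemma regInvNorm_sq {ε : ℝ} (hε : 0 < ε) (y : Space N) :
    regInvNorm ε y ^ 2 = (‖y‖ ^ 2 + ε)⁻¹ := by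
  rw [regInvNorm, inv_pow, Real.sq_sqrt (by positivity)]

lemma fderiv_regInvNorm_self {ε : ℝ} (hε : 0 < ε) (y : Space N) :
    fderiv ℝ (regInvNorm ε : Space N → ℝ) y y = -(‖y‖ ^ 2 * regInvNorm ε y ^ 3) := by
  have hpos : 0 < ‖y‖ ^ 2 + ε := by positivity
  have h₁ : HasFDerivAt (fun z : Space N => ‖z‖ ^ 2 + ε) (2 • innerSL ℝ y) y :=
    (hasStrictFDerivAt_norm_sq y).hasFDerivAt.add_const ε
  have hs : √(‖y‖ ^ 2 + ε) ≠ 0 := (Real.sqrt_pos.2 hpos).ne'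
  have h₂ := (hasDerivAt_inv hs).comp_hasFDerivAt y (h₁.sqrt hpos.ne')
  have hy : (innerSL ℝ y) y = ‖y‖ ^ 2 := real_inner_self_eq_norm_sq y
  change fderiv ℝ (Inv.inv ∘ fun z : Space N => √(‖z‖ ^ 2 + ε)) y y = _
  rw [h₂.fderiv]
  simp only [smul_apply, hy, smul_eq_mul, regInvNorm]
  field_simp
  rw [two_nsmul]
  ring

/-- A test function multiplied by `(|y|² + ε)^(-1/2)`. -/
def TestFn.mulReg {ε : ℝ} (hε : 0 < ε) (φ : TestFn N) : TestFn N :=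
  ⟨fun y => φ.fn y * regInvNorm ε y, φ.contDiff.mul (contDiff_regInvNorm hε),
    φ.hasCompactSupport.mul_right⟩

lemma TestFn.fderiv_mulReg_self {ε : ℝ} (hε : 0 < ε) (φ : TestFn N) (y : Space N) :
    fderiv ℝ (φ.mulReg hε).fn y y = fderiv ℝ φ.fn y y * regInvNorm ε y
      - φ.fn y * (‖y‖ ^ 2 * regInvNorm ε y ^ 3) := by
  change fderiv ℝ (fun z => φ.fn z * regInvNorm ε z) y y = _
  rw [fderiv_fun_mul φ.differentiable.differentiableAt
    ((contDiff_regInvNorm hε).differentiable (by simp) y)]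
  simp only [add_apply, smul_apply, smul_eq_mul, fderiv_regInvNorm_self hε]
  ring

/-- A regularised Hardy inequality. -/
lemma TestFn.hardy_reg (hN : 3 ≤ N) {ε : ℝ} (hε : 0 < ε) (φ : TestFn N) :
    ‖toL2 N (φ.mulReg hε)‖ ^ 2 ≤ 4 * ‖φ‖ ^ 2 := by
  rw [norm_sq_eq, norm_toL2_sq_eq]
  -- Regularising `φ / |y|` keeps it a test function, so the radial integration by parts applies to
  -- it.
  set χ := φ.mulReg hε with hχ
  have hr := χ.integral_radial
  simp only [χ.fderiv_radial] at hr
  have hN' : (3 : ℝ) ≤ N := by exact_mod_cast hN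
  -- The middle term integrates to `-N ∫ K χ²`. The total is therefore `2‖φ‖² - (1/2) ∫ K χ²`, whose
  -- nonnegativity is the claim with constant 4.
  have hpt : ∀ y : Space N, 0 ≤ 2 * (weight y * ‖∇ φ.fn y‖ ^ 2)
      + (weight y * (2 * χ.fn y * inner ℝ (∇ χ.fn y) y + χ.fn y ^ 2 * (‖y‖ ^ 2 / 2)))
      + (N - 1 / 2) * (weight y * χ.fn y ^ 2) := by
    intro y
    have hχy : χ.fn y = φ.fn y * regInvNorm ε y := rfl
    rw [inner_gradient_eq, φ.fderiv_mulReg_self hε, hχy, ← inner_gradient_eq]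
    set a := φ.fn y
    set q := regInvNorm ε y with hq
    have hq0 : 0 ≤ q := inv_nonneg.2 (Real.sqrt_nonneg _)
    have hq2 : ‖y‖ ^ 2 * q ^ 2 ≤ 1 := by
      rw [hq, regInvNorm_sq hε, ← div_eq_mul_inv, div_le_one (by positivity)]
      linarith
    have hyq : ‖y‖ * q ≤ 1 := by
      rw [← mul_pow] at hq2
      exact (sq_le_one_iff₀ (by positivity)).1 hq2
    set b := inner ℝ (∇ φ.fn y) y with hb
    have hbq : |b * q| ≤ ‖∇ φ.fn y‖ := by
      rw [abs_mul, abs_of_nonneg hq0]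
      calc _ ≤ ‖∇ φ.fn y‖ * ‖y‖ * q :=
            mul_le_mul_of_nonneg_right (abs_real_inner_le_norm _ _) hq0
        _ = ‖∇ φ.fn y‖ * (‖y‖ * q) := by ring
        _ ≤ _ := mul_le_of_le_one_right (norm_nonneg _) hyq
    have hbq2 : (b * q) ^ 2 ≤ ‖∇ φ.fn y‖ ^ 2 :=
      sq_le_sq.2 (by rwa [abs_of_nonneg (norm_nonneg (∇ φ.fn y))])
    -- With `2|∇φ|² ≥ 2(bq)²`, completing the square costs `(aq)²/2` and the term in `q³` costs at
    -- most `2(aq)²`. What remains of `N - 1/2` is `N - 3`, whence the dimension restriction.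
    have key : 0 ≤ 2 * ‖∇ φ.fn y‖ ^ 2 + 2 * (a * q) * (b * q - a * (‖y‖ ^ 2 * q ^ 3))
        + (a * q) ^ 2 * (‖y‖ ^ 2 / 2) + (N - 1 / 2) * (a * q) ^ 2 := by
      have e₁ : 2 * (a * q) * (b * q - a * (‖y‖ ^ 2 * q ^ 3))
          = 2 * (a * q) * (b * q) - 2 * (a * q) ^ 2 * (‖y‖ ^ 2 * q ^ 2) := by ring
      have e₂ := sq_nonneg (a * q / 2 + b * q)
      have e₃ : (a * q) ^ 2 * (‖y‖ ^ 2 * q ^ 2) ≤ (a * q) ^ 2 :=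
        mul_le_of_le_one_right (sq_nonneg _) hq2
      have e₄ : 0 ≤ (a * q) ^ 2 * (‖y‖ ^ 2 / 2) := by positivity
      have e₅ : 0 ≤ (N - 3 : ℝ) * (a * q) ^ 2 := mul_nonneg (by linarith) (sq_nonneg _)
      rw [e₁]
      nlinarith
    refine (mul_nonneg (weight_pos y).le key).trans_eq ?_
    ring
  have hle := integral_nonneg (μ := (volume : Measure (Space N))) (Pi.le_def.2 hpt)
  rw [integral_add (f := fun y => 2 * (weight y * ‖∇ φ.fn y‖ ^ 2) + (weight y *
    (2 * χ.fn y * inner ℝ (∇ χ.fn y) y + χ.fn y ^ 2 * (‖y‖ ^ 2 / 2))))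
    ((φ.integrable_gradient_sq.const_mul _).add χ.integrable_radial)
    (χ.integrable_sq.const_mul _)] at hle
  rw [integral_add (φ.integrable_gradient_sq.const_mul _)
    χ.integrable_radial, integral_const_mul, integral_const_mul, hr] at hle
  linarith

lemma ae_weightMeasure {P : Space N → Prop} (h : ∀ᵐ y, P y) : ∀ᵐ y ∂(weightMeasure N), P y :=
  (withDensity_absolutelyContinuous _ _).ae_le h

variable [Fact (3 ≤ N)]

/-- Elements of `X` are limits, in norm and almost everywhere, of test functions. -/
lemma exists_seq_testFn_tendsto (u : X N) :
    ∃ φ : ℕ → TestFn N, Tendsto (fun n => (φ n : X N)) atTop (𝓝 u) ∧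
      ∀ᵐ y ∂(weightMeasure N), Tendsto (fun n => (φ n).fn y) atTop (𝓝 (emb N u y)) := by
  obtain ⟨x, hx, hxu⟩ := mem_closure_iff_seq_limit.1
    (UniformSpace.Completion.denseRange_coe (α := TestFn N) u)
  choose φ hφ using hx
  have h₁ : Tendsto (fun n => (φ n : X N)) atTop (𝓝 u) := by simpa only [hφ] using hxu
  have h₂ := ((emb N).continuous.tendsto u).comp h₁
  obtain ⟨k, hk, hk'⟩ := (tendstoInMeasure_of_tendsto_Lp h₂).exists_seq_tendsto_ae
  refine ⟨fun n => φ (k n), h₁.comp hk.tendsto_atTop, ?_⟩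
  have h₃ : ∀ᵐ y ∂(weightMeasure N), ∀ n, TestFn.toL2 N (φ n) y = (φ n).fn y :=
    ae_all_iff.2 fun n => (φ n).memLp_fn.coeFn_toLp
  filter_upwards [hk', h₃] with y hy₁ hy₂
  simpa only [Function.comp_apply, emb_coe, hy₂] using hy₁

/-- Bounds in weighted Lebesgue spaces pass from test functions to `X`. -/
lemma eLpNorm_emb_mul_le {p c : ℝ≥0∞} (hc : c ≠ ⊤) {q : ℕ → Space N → ℝ} {Q : Space N → ℝ}
    (hq : ∀ n, Continuous (q n))
    (hqQ : ∀ᵐ y ∂(weightMeasure N), Tendsto (fun n => q n y) atTop (𝓝 (Q y)))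
    (h : ∀ n (φ : TestFn N), eLpNorm (fun y => φ.fn y * q n y) p (weightMeasure N) ≤ c * ‖φ‖ₑ)
    (u : X N) : eLpNorm (fun y => emb N u y * Q y) p (weightMeasure N) ≤ c * ‖u‖ₑ := by
  obtain ⟨φ, hφ, hae⟩ := exists_seq_testFn_tendsto u
  have h₁ : ∀ᵐ y ∂(weightMeasure N),
      Tendsto (fun n => (φ n).fn y * q n y) atTop (𝓝 (emb N u y * Q y)) := by
    filter_upwards [hqQ, hae] with y h₁ h₂ using h₂.mul h₁
  -- Fatou: the approximation of `u` and the regularisation of `Q` are removed in the same limit.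
  refine (Lp.eLpNorm_lim_le_liminf_eLpNorm
    (fun n => ((φ n).contDiff.continuous.mul (hq n)).aestronglyMeasurable) _ h₁).trans ?_
  have h₂ : Tendsto (fun n => c * ‖(φ n : X N)‖ₑ) atTop (𝓝 (c * ‖u‖ₑ)) :=
    ENNReal.Tendsto.const_mul (hφ.enorm) (Or.inr hc)
  rw [← h₂.liminf_eq]
  refine liminf_le_liminf (Eventually.of_forall fun n => (h n (φ n)).trans_eq ?_)
  congr 1
  rw [← ofReal_norm, ← ofReal_norm, UniformSpace.Completion.norm_coe]

lemma three_le : 3 ≤ N := Fact.out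

instance : Nonempty (Fin N) := ⟨⟨0, lt_of_lt_of_le (by norm_num) (three_le (N := N))⟩⟩

/-- The Hardy inequality in `X`. -/
lemma eLpNorm_emb_mul_inv_norm_le (u : X N) :
    eLpNorm (fun y => emb N u y * ‖y‖⁻¹) 2 (weightMeasure N) ≤ 2 * ‖u‖ₑ := by
  have hpos : ∀ n : ℕ, (0 : ℝ) < 1 / ((n : ℝ) + 1) := fun n => by positivity
  refine eLpNorm_emb_mul_le (q := fun n => regInvNorm (1 / ((n : ℝ) + 1))) (by simp)
    (fun n => (contDiff_regInvNorm (hpos n)).continuous) ?_ (fun n φ => ?_) u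
  · refine ae_weightMeasure ?_
    filter_upwards [Measure.ae_ne volume (0 : Space N)] with y hy
    have hy' : ‖y‖ ≠ 0 := norm_ne_zero_iff.2 hy
    have h : Tendsto (fun n : ℕ => (√(‖y‖ ^ 2 + 1 / ((n : ℝ) + 1)))⁻¹) atTop
        (𝓝 (√(‖y‖ ^ 2 + 0))⁻¹) := by
      refine Tendsto.inv₀ ?_ (by simpa using hy')
      exact (tendsto_const_nhds.add tendsto_one_div_add_atTop_nhds_zero_nat).sqrt
    simpa [regInvNorm] using h
  · have h := φ.hardy_reg three_le (hpos n)
    have h' : ‖TestFn.toL2 N (φ.mulReg (hpos n))‖ ≤ 2 * ‖φ‖ :=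
      le_of_sq_le_sq (h.trans_eq (by ring)) (by positivity)
    have e : eLpNorm (fun y => φ.fn y * regInvNorm (1 / ((n : ℝ) + 1)) y) 2 (weightMeasure N)
        = ‖TestFn.toL2 N (φ.mulReg (hpos n))‖ₑ :=
      (Lp.enorm_toLp (hf := (φ.mulReg (hpos n)).memLp_fn)).symm
    rw [e, ← ofReal_norm, ← ofReal_norm]
    refine (ENNReal.ofReal_le_ofReal h').trans_eq ?_
    rw [ENNReal.ofReal_mul (by norm_num), ENNReal.ofReal_ofNat]

lemma memLp_emb_mul_inv_norm (u : X N) :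
    MemLp (fun y => emb N u y * ‖y‖⁻¹) 2 (weightMeasure N) :=
  ⟨(Lp.aestronglyMeasurable _).mul
      (continuous_norm.measurable.inv.aestronglyMeasurable),
    (eLpNorm_emb_mul_inv_norm_le u).trans_lt (ENNReal.mul_lt_top (by simp) enorm_lt_top)⟩

/-- The operator `u ↦ u / |y|` from `X` to `L²_K`. -/
def hardyCLM (N : ℕ) [Fact (3 ≤ N)] : X N →L[ℝ] L2K N :=
  LinearMap.mkContinuous
    { toFun := fun u => (memLp_emb_mul_inv_norm u).toLp _
      map_add' := fun u w => by
        rw [← MemLp.toLp_add]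
        refine MemLp.toLp_congr _ _ ?_
        rw [map_add]
        filter_upwards [Lp.coeFn_add (emb N u) (emb N w)] with y hy
        simp only [hy, Pi.add_apply, add_mul]
      map_smul' := fun c u => by
        rw [RingHom.id_apply, ← MemLp.toLp_const_smul]
        refine MemLp.toLp_congr _ _ ?_
        rw [map_smul]
        filter_upwards [Lp.coeFn_smul c (emb N u)] with y hy
        simp only [hy, Pi.smul_apply, smul_eq_mul, mul_assoc] } 2 fun u => by
    have h := eLpNorm_emb_mul_inv_norm_le u
    rw [LinearMap.coe_mk, AddHom.coe_mk, Lp.norm_toLp]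
    refine (ENNReal.toReal_mono (ENNReal.mul_ne_top (by simp) enorm_ne_top) h).trans_eq ?_
    simp

lemma coeFn_hardyCLM (u : X N) :
    hardyCLM N u =ᵐ[weightMeasure N] fun y => emb N u y * ‖y‖⁻¹ :=
  (memLp_emb_mul_inv_norm u).coeFn_toLp

end Hardy

/-! ### The weighted critical Sobolev inequality. -/

section Sobolev

variable {N : ℕ}

/-- The substitution `φ ↦ K^(1/2) φ`. -/
def TestFn.sqrtWeightMul (φ : TestFn N) (y : Space N) : ℝ := Real.exp (‖y‖ ^ 2 / 8) * φ.fn y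

lemma TestFn.contDiff_sqrtWeightMul (φ : TestFn N) : ContDiff ℝ ∞ φ.sqrtWeightMul :=
  (((contDiff_norm_sq ℝ).div_const _).exp).mul φ.contDiff

lemma TestFn.hasCompactSupport_sqrtWeightMul (φ : TestFn N) :
    HasCompactSupport φ.sqrtWeightMul := φ.hasCompactSupport.mul_left

/-- The gradient is `K^(1/2) (∇φ + (φ/4) y)`. Its square is arranged so that the cross term sits
inside the radial derivative of `K φ²`, whose integral is known. -/
lemma TestFn.norm_fderiv_sqrtWeightMul_sq (φ : TestFn N) (y : Space N) :
    ‖fderiv ℝ φ.sqrtWeightMul y‖ ^ 2 = weight y * ‖∇ φ.fn y‖ ^ 2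
      + 1 / 4 * (weight y * (2 * φ.fn y * inner ℝ (∇ φ.fn y) y + φ.fn y ^ 2 * (‖y‖ ^ 2 / 2)))
      - 1 / 16 * (weight y * (φ.fn y ^ 2 * ‖y‖ ^ 2)) := by
  have h₁ : HasFDerivAt (fun z : Space N => Real.exp (‖z‖ ^ 2 * (1 / 8)))
      (Real.exp (‖y‖ ^ 2 * (1 / 8)) • (1 / 8 : ℝ) • 2 • innerSL ℝ y) y :=
    ((hasStrictFDerivAt_norm_sq y).hasFDerivAt.mul_const (1 / 8 : ℝ)).exp
  have h₂ : HasFDerivAt φ.fn (fderiv ℝ φ.fn y) y := φ.differentiable.differentiableAt.hasFDerivAt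
  have hf : φ.sqrtWeightMul = fun z => Real.exp (‖z‖ ^ 2 * (1 / 8)) * φ.fn z := by
    funext z
    rw [sqrtWeightMul, div_eq_mul_one_div]
  have e : fderiv ℝ φ.sqrtWeightMul y
      = innerSL ℝ (Real.exp (‖y‖ ^ 2 * (1 / 8)) • (∇ φ.fn y + (φ.fn y / 4) • y)) := by
    rw [hf, (h₁.fun_mul h₂).fderiv]
    ext z
    simp only [add_apply, smul_apply, innerSL_apply_apply, smul_eq_mul, inner_smul_left,
      inner_add_left, inner_gradient_eq, conj_trivial]
    simp
    ring
  have hw : Real.exp (‖y‖ ^ 2 * (1 / 8)) ^ 2 = weight y := by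
    rw [weight, ← Real.exp_nat_mul]
    congr 1
    push_cast
    ring
  rw [e, innerSL_apply_norm, norm_smul, mul_pow, Real.norm_eq_abs, sq_abs, hw, norm_add_sq_real,
    inner_smul_right, norm_smul, mul_pow, Real.norm_eq_abs, sq_abs]
  ring

/-- After integration the radial term becomes `-(N/4) ∫ K φ²`, and the last term is nonpositive as
well. -/
lemma TestFn.integral_norm_fderiv_sqrtWeightMul_sq_le (φ : TestFn N) :
    ∫ y, ‖fderiv ℝ φ.sqrtWeightMul y‖ ^ 2 ≤ ‖φ‖ ^ 2 := by
  have hr := φ.integral_radial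
  simp only [φ.fderiv_radial] at hr
  have hi : Integrable fun y : Space N => weight y * (φ.fn y ^ 2 * ‖y‖ ^ 2) := by
    have s : HasCompactSupport fun y => φ.fn y ^ 2 :=
      φ.hasCompactSupport.comp_left (g := fun t : ℝ => t ^ 2) (by simp)
    exact (contDiff_weight.continuous.mul ((φ.contDiff.continuous.pow 2).mul
      (continuous_norm.pow 2))).integrable_of_hasCompactSupport s.mul_right.mul_left
  simp only [φ.norm_fderiv_sqrtWeightMul_sq]
  rw [integral_sub (f := fun y => weight y * ‖∇ φ.fn y‖ ^ 2 + 1 / 4 * (weight y *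
    (2 * φ.fn y * inner ℝ (∇ φ.fn y) y + φ.fn y ^ 2 * (‖y‖ ^ 2 / 2))))
    (φ.integrable_gradient_sq.add (φ.integrable_radial.const_mul _))
    (hi.const_mul _), integral_add φ.integrable_gradient_sq (φ.integrable_radial.const_mul _),
    integral_const_mul, integral_const_mul, hr, norm_sq_eq]
  have p₁ : 0 ≤ ∫ y : Space N, weight y * (φ.fn y ^ 2 * ‖y‖ ^ 2) :=
    integral_nonneg fun y => mul_nonneg (weight_pos y).le (by positivity)
  have p₂ : 0 ≤ (N : ℝ) * ∫ y : Space N, weight y * φ.fn y ^ 2 :=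
    mul_nonneg (by positivity) (integral_nonneg fun y => mul_nonneg (weight_pos y).le (sq_nonneg _))
  linarith

lemma TestFn.eLpNorm_fderiv_sqrtWeightMul_le (φ : TestFn N) :
    eLpNorm (fderiv ℝ φ.sqrtWeightMul) 2 volume ≤ ‖φ‖ₑ := by
  have hm : MemLp (fderiv ℝ φ.sqrtWeightMul) 2 (volume : Measure (Space N)) :=
    (φ.contDiff_sqrtWeightMul.continuous_fderiv (by simp)).memLp_of_hasCompactSupport
      (φ.hasCompactSupport_sqrtWeightMul.fderiv (𝕜 := ℝ))
  rw [hm.eLpNorm_eq_integral_rpow_norm (by simp) (by simp), ← ofReal_norm]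
  refine ENNReal.ofReal_le_ofReal ?_
  have h := φ.integral_norm_fderiv_sqrtWeightMul_sq_le
  simp only [ENNReal.toReal_ofNat, Real.rpow_ofNat]
  rw [← one_div, ← Real.sqrt_eq_rpow]
  exact Real.sqrt_le_iff.2 ⟨norm_nonneg _, h⟩

variable [Fact (3 ≤ N)]

omit [Fact (3 ≤ N)] in
lemma pExp_eq : pExp N + 1 = 2 * N / (N - 2) := by
  rw [pExp, sub_add_cancel]

lemma three_le_cast : (3 : ℝ) ≤ N := by exact_mod_cast three_le (N := N)

lemma one_lt_pExp : 1 < pExp N := by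
  have h := three_le_cast (N := N)
  rw [pExp, lt_sub_iff_add_lt, lt_div_iff₀ (by linarith)]
  linarith

/-- The critical exponent `2* = p + 1` as a nonnegative real. -/
def critExp (N : ℕ) : NNReal := (pExp N + 1).toNNReal

lemma coe_critExp : (critExp N : ℝ) = pExp N + 1 :=
  Real.coe_toNNReal _ (by linarith [one_lt_pExp (N := N)])

lemma critExp_ne_zero : (critExp N : ℝ≥0∞) ≠ 0 := by
  rw [ENNReal.coe_ne_zero, ← NNReal.coe_ne_zero, coe_critExp]
  linarith [one_lt_pExp (N := N)]

/-- The constant in the Sobolev inequality. -/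
def sobolevConst (N : ℕ) : NNReal :=
  eLpNormLESNormFDerivOfEqInnerConst (volume : Measure (Space N)) ((2 : NNReal) : ℝ)

/-- The weighted Sobolev inequality for test functions. -/
lemma TestFn.eLpNorm_critExp_le (φ : TestFn N) :
    eLpNorm φ.fn (critExp N) (weightMeasure N) ≤ sobolevConst N * ‖φ‖ₑ := by
  have hN := three_le_cast (N := N)
  have hfr : Module.finrank ℝ (Space N) = N := by simp
  have hgns : eLpNorm φ.sqrtWeightMul (critExp N) volume
      ≤ sobolevConst N * eLpNorm (fderiv ℝ φ.sqrtWeightMul) (2 : NNReal) volume := by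
    have hexp : ((critExp N : NNReal) : ℝ)⁻¹
        = ((2 : NNReal) : ℝ)⁻¹ - (Module.finrank ℝ (Space N) : ℝ)⁻¹ := by
      rw [hfr, coe_critExp, pExp_eq]
      have : (N : ℝ) - 2 ≠ 0 := by linarith
      have : (N : ℝ) ≠ 0 := by linarith
      push_cast
      field_simp
    have hfr' : 0 < Module.finrank ℝ (Space N) := by
      rw [hfr]
      exact lt_of_lt_of_le (by norm_num) (three_le (N := N))
    have hsm : ContDiff ℝ 1 φ.sqrtWeightMul := φ.contDiff_sqrtWeightMul.of_le (by simp)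
    exact eLpNorm_le_eLpNorm_fderiv_of_eq_inner (volume : Measure (Space N)) hsm
      φ.hasCompactSupport_sqrtWeightMul one_le_two hfr' hexp
  refine le_trans ?_ (hgns.trans (mul_le_mul_right φ.eLpNorm_fderiv_sqrtWeightMul_le _))
  rw [eLpNorm_eq_lintegral_rpow_enorm_toReal critExp_ne_zero ENNReal.coe_ne_top,
    eLpNorm_eq_lintegral_rpow_enorm_toReal critExp_ne_zero ENNReal.coe_ne_top]
  refine ENNReal.rpow_le_rpow ?_ (by positivity)
  rw [weightMeasure, lintegral_withDensity_eq_lintegral_mul₀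
    contDiff_weight.continuous.measurable.ennreal_ofReal.aemeasurable
    (φ.contDiff.continuous.enorm.measurable.pow_const _).aemeasurable]
  -- Pointwise `K |φ|^{2*} ≤ |K^(1/2) φ|^{2*}`, because `K ≥ 1` and `2* ≥ 2`.
  refine lintegral_mono fun y => ?_
  have hp : 2 ≤ (critExp N : ℝ) := by
    rw [coe_critExp]
    linarith [one_lt_pExp (N := N)]
  rw [ENNReal.coe_toReal, TestFn.sqrtWeightMul, enorm_mul,
    ENNReal.mul_rpow_of_nonneg _ _ (by linarith), Pi.mul_apply]
  gcongr
  rw [Real.enorm_eq_ofReal (Real.exp_pos _).le,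
    ENNReal.ofReal_rpow_of_pos (Real.exp_pos _), ← Real.exp_mul]
  refine ENNReal.ofReal_le_ofReal (Real.exp_le_exp.2 ?_)
  nlinarith [sq_nonneg ‖y‖]

/-- The weighted Sobolev inequality in `X`. -/
lemma eLpNorm_emb_critExp_le (u : X N) :
    eLpNorm (emb N u) (critExp N) (weightMeasure N) ≤ sobolevConst N * ‖u‖ₑ := by
  have h := eLpNorm_emb_mul_le (N := N) (p := critExp N) (c := sobolevConst N) (q := fun _ _ => 1)
    (Q := fun _ => 1) ENNReal.coe_ne_top (fun _ => continuous_const)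
    (Eventually.of_forall fun _ => tendsto_const_nhds)
    (fun _ φ => by simpa only [mul_one] using φ.eLpNorm_critExp_le) u
  simpa only [mul_one] using h

lemma memLp_emb_critExp (u : X N) : MemLp (emb N u) (critExp N) (weightMeasure N) :=
  ⟨Lp.aestronglyMeasurable _, (eLpNorm_emb_critExp_le u).trans_lt
    (ENNReal.mul_lt_top ENNReal.coe_lt_top enorm_lt_top)⟩

lemma integrable_emb_critExp (u : X N) :
    Integrable (fun y => |emb N u y| ^ (pExp N + 1)) (weightMeasure N) := by
  have h := (memLp_emb_critExp u).integrable_norm_rpow critExp_ne_zero ENNReal.coe_ne_top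
  simpa only [ENNReal.coe_toReal, coe_critExp, Real.norm_eq_abs] using h

lemma integral_emb_critExp_le (u : X N) :
    ∫ y, |emb N u y| ^ (pExp N + 1) ∂(weightMeasure N)
      ≤ (sobolevConst N * ‖u‖) ^ (pExp N + 1) := by
  have h := eLpNorm_emb_critExp_le u
  rw [(memLp_emb_critExp u).eLpNorm_eq_integral_rpow_norm critExp_ne_zero ENNReal.coe_ne_top,
    ← ofReal_norm, ← ENNReal.ofReal_coe_nnreal (p := sobolevConst N),
    ← ENNReal.ofReal_mul (by positivity),
    ENNReal.ofReal_le_ofReal_iff (by positivity)] at h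
  simp only [ENNReal.coe_toReal, coe_critExp, Real.norm_eq_abs] at h
  have hp : 0 < pExp N + 1 := by linarith [one_lt_pExp (N := N)]
  rwa [Real.rpow_inv_le_iff_of_pos (by positivity) (by positivity) hp] at h

end Sobolev

/-! ### Local compactness via the Fourier transform. -/

section Rellich

open scoped FourierTransform LineDeriv SchwartzMap

variable {N : ℕ}

lemma one_le_weight (y : Space N) : 1 ≤ weight y := Real.one_le_exp (by positivity)

lemma integrable_inv_weight : Integrable fun y : Space N => (weight y)⁻¹ := by
  have h := GaussianFourier.integrable_cexp_neg_mul_sq_norm_add (V := Space N)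
    (b := ((1 / 4 : ℝ) : ℂ)) (by rw [Complex.ofReal_re]; norm_num) 0 0
  refine h.norm.congr (Eventually.of_forall fun y => ?_)
  simp only [zero_mul, add_zero]
  rw [Complex.norm_exp, weight, ← Real.exp_neg]
  congr 1
  rw [← Complex.ofReal_pow, ← Complex.ofReal_neg, ← Complex.ofReal_mul, Complex.ofReal_re]
  ring

/-- Since `K⁻¹` is integrable, `K⁻¹ g` lies in `L²_K`. Thus unweighted integration against real
Fourier modes is continuous on `L²_K`. -/
lemma exists_integral_mul_eq_inner {g : Space N → ℝ} (hg : Continuous g) (hg1 : ∀ y, |g y| ≤ 1) :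
    ∃ ℓ : L2K N, ∀ φ : TestFn N, ∫ y, g y * φ.fn y = inner ℝ (TestFn.toL2 N φ) ℓ := by
  let l : Space N → ℝ := fun y => (weight y)⁻¹ * g y
  have hl : Continuous l :=
    (contDiff_weight.continuous.inv₀ fun y => (weight_pos y).ne').mul hg
  have hm : MemLp l 2 (weightMeasure N) := by
    rw [memLp_two_iff_integrable_sq hl.aestronglyMeasurable, weightMeasure,
      integrable_withDensity_iff contDiff_weight.continuous.measurable.ennreal_ofReal (by simp)]
    refine integrable_inv_weight.mono' ((hl.pow 2).measurable.mul
      contDiff_weight.continuous.measurable.ennreal_ofReal.ennreal_toReal).aestronglyMeasurable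
      (Eventually.of_forall fun y => ?_)
    have hw := weight_pos y
    have hg2 : g y ^ 2 ≤ 1 := (sq_le_one_iff_abs_le_one _).2 (hg1 y)
    rw [ENNReal.toReal_ofReal hw.le, Real.norm_eq_abs, abs_of_nonneg (by positivity)]
    have e : l y ^ 2 * weight y = (weight y)⁻¹ * g y ^ 2 := by
      simp only [l]
      field_simp
    rw [e]
    exact mul_le_of_le_one_right (by positivity) hg2
  refine ⟨hm.toLp l, fun φ => ?_⟩
  rw [L2.inner_def]
  have hr : ∫ y, inner ℝ (TestFn.toL2 N φ y) (hm.toLp l y) ∂(weightMeasure N)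
      = ∫ y, φ.fn y * l y ∂(weightMeasure N) := by
    refine integral_congr_ae ?_
    filter_upwards [φ.memLp_fn.coeFn_toLp, hm.coeFn_toLp] with y h₁ h₂
    change inner ℝ (φ.memLp_fn.toLp _ y) _ = _
    rw [h₁, h₂, RCLike.inner_apply, conj_trivial, mul_comm]
  rw [hr, integral_weightMeasure]
  refine integral_congr_ae (Eventually.of_forall fun y => ?_)
  have hw := (weight_pos y).ne'
  simp only [l]
  field_simp

/-- A test function as a complex Schwartz function. -/
def TestFn.toSchwartz (φ : TestFn N) : 𝓢(Space N, ℂ) :=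
  HasCompactSupport.toSchwartzMap (f := fun y => (φ.fn y : ℂ))
    (φ.hasCompactSupport.comp_left (g := fun t : ℝ => (t : ℂ)) Complex.ofReal_zero)
    (Complex.ofRealCLM.contDiff.comp φ.contDiff)

lemma TestFn.toSchwartz_apply (φ : TestFn N) (y : Space N) : φ.toSchwartz y = (φ.fn y : ℂ) := rfl

lemma TestFn.integrable (φ : TestFn N) : Integrable φ.fn :=
  φ.contDiff.continuous.integrable_of_hasCompactSupport φ.hasCompactSupport

lemma TestFn.integral_fourier_sq (φ : TestFn N) :
    ∫ ξ, ‖𝓕 φ.toSchwartz ξ‖ ^ 2 = ∫ y, φ.fn y ^ 2 := by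
  rw [SchwartzMap.integral_norm_sq_fourier]
  simp [TestFn.toSchwartz_apply]

lemma _root_.SchwartzMap.integrable_norm_sq (f : 𝓢(Space N, ℂ)) :
    Integrable fun ξ => ‖f ξ‖ ^ 2 :=
  (f.memLp 2 volume).integrable_norm_pow (by norm_num)

lemma TestFn.norm_fourier_lineDeriv_sq (φ : TestFn N) (i : Fin N) (ξ : Space N) :
    ‖𝓕 (∂_{EuclideanSpace.single i (1 : ℝ)} φ.toSchwartz) ξ‖ ^ 2
      = (2 * Real.pi) ^ 2 * (ξ i ^ 2 * ‖𝓕 φ.toSchwartz ξ‖ ^ 2) := by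
  have ht : (inner ℝ · (EuclideanSpace.single i (1 : ℝ)) : Space N → ℝ).HasTemperateGrowth :=
    ((innerSL ℝ).flip _).hasTemperateGrowth
  rw [SchwartzMap.fourier_lineDerivOp_eq, smul_apply,
    SchwartzMap.smulLeftCLM_apply_apply ht, EuclideanSpace.inner_single_right]
  simp [mul_pow]

lemma TestFn.integral_lineDeriv_sq (φ : TestFn N) (i : Fin N) :
    ∫ y, ‖(∂_{EuclideanSpace.single i (1 : ℝ)} φ.toSchwartz) y‖ ^ 2 = ∫ y, (∇ φ.fn y i) ^ 2 := by
  refine integral_congr_ae (Eventually.of_forall fun y => ?_)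
  have h : HasFDerivAt (fun y => (φ.fn y : ℂ)) (Complex.ofRealCLM.comp (fderiv ℝ φ.fn y)) y :=
    Complex.ofRealCLM.hasFDerivAt.comp y φ.differentiable.differentiableAt.hasFDerivAt
  have e : (∂_{EuclideanSpace.single i (1 : ℝ)} φ.toSchwartz) y = ((∇ φ.fn y i : ℝ) : ℂ) := by
    rw [SchwartzMap.lineDerivOp_apply_eq_fderiv, gradient_apply]
    change fderiv ℝ (fun y => (φ.fn y : ℂ)) y _ = _
    rw [h.fderiv]
    rfl
  simp only [e, Complex.norm_real, Real.norm_eq_abs, sq_abs]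

lemma TestFn.integrable_fourier_moment (φ : TestFn N) (i : Fin N) :
    Integrable fun ξ : Space N => ξ i ^ 2 * ‖𝓕 φ.toSchwartz ξ‖ ^ 2 := by
  have h := (𝓕 (∂_{EuclideanSpace.single i (1 : ℝ)} φ.toSchwartz)).integrable_norm_sq
  simp only [φ.norm_fourier_lineDeriv_sq] at h
  exact (integrable_const_mul_iff (IsUnit.mk0 _ (by positivity)) _).1 h

/-- Plancherel for each partial derivative; the factors `(2π)²` and `K` are at least one and are
dropped. -/
lemma TestFn.integral_fourier_moment_le (φ : TestFn N) :
    ∫ ξ : Space N, ‖ξ‖ ^ 2 * ‖𝓕 φ.toSchwartz ξ‖ ^ 2 ≤ ‖φ‖ ^ 2 := by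
  have hsq : ∀ z : Space N, ‖z‖ ^ 2 = ∑ i, z i ^ 2 := fun z => EuclideanSpace.real_norm_sq_eq z
  have h₁ : ∀ i, (2 * Real.pi) ^ 2 * ∫ ξ : Space N, ξ i ^ 2 * ‖𝓕 φ.toSchwartz ξ‖ ^ 2
      = ∫ y, (∇ φ.fn y i) ^ 2 := by
    intro i
    rw [← φ.integral_lineDeriv_sq, ← SchwartzMap.integral_norm_sq_fourier, ← integral_const_mul]
    simp only [φ.norm_fourier_lineDeriv_sq]
  have hi : ∀ i, Integrable fun y => (∇ φ.fn y i) ^ 2 := fun i => by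
    have c : Continuous fun y => ∇ φ.fn y i :=
      (EuclideanSpace.proj i : Space N →L[ℝ] ℝ).continuous.comp φ.continuous_gradient
    refine (c.pow 2).integrable_of_hasCompactSupport
      (φ.hasCompactSupport_gradient.mono fun y hy hy0 => hy ?_)
    change (∇ φ.fn y i) ^ 2 = 0
    rw [hy0]
    simp
  have h₂ : (2 * Real.pi) ^ 2 * ∫ ξ : Space N, ‖ξ‖ ^ 2 * ‖𝓕 φ.toSchwartz ξ‖ ^ 2
      = ∫ y, ‖∇ φ.fn y‖ ^ 2 := by
    have e₁ : ∫ ξ : Space N, ∑ i, ξ i ^ 2 * ‖𝓕 φ.toSchwartz ξ‖ ^ 2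
        = ∑ i, ∫ ξ : Space N, ξ i ^ 2 * ‖𝓕 φ.toSchwartz ξ‖ ^ 2 :=
      integral_finsetSum _ fun i _ => φ.integrable_fourier_moment i
    have e₂ : ∫ y, ∑ i, (∇ φ.fn y i) ^ 2 = ∑ i, ∫ y, (∇ φ.fn y i) ^ 2 :=
      integral_finsetSum _ fun i _ => hi i
    simp only [hsq, Finset.sum_mul]
    rw [e₁, e₂, Finset.mul_sum]
    exact Finset.sum_congr rfl fun i _ => h₁ i
  have h₃ : ∫ y, ‖∇ φ.fn y‖ ^ 2 ≤ ‖φ‖ ^ 2 := by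
    rw [norm_sq_eq]
    refine integral_mono ?_ φ.integrable_gradient_sq fun y =>
      le_mul_of_one_le_left (sq_nonneg _) (one_le_weight y)
    simp only [hsq]
    exact integrable_finsetSum _ fun i _ => hi i
  have h₄ : 0 ≤ ∫ ξ : Space N, ‖ξ‖ ^ 2 * ‖𝓕 φ.toSchwartz ξ‖ ^ 2 :=
    integral_nonneg fun ξ => by positivity
  have h₅ : 1 ≤ (2 * Real.pi) ^ 2 := by nlinarith [Real.pi_gt_three]
  nlinarith

/-- The high frequencies of a test function are controlled by its norm in `X`. -/
lemma TestFn.integral_sq_le (φ : TestFn N) {R : ℝ} (hR : 0 < R) :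
    ∫ y, φ.fn y ^ 2
      ≤ (∫ ξ in Metric.ball 0 R, ‖𝓕 φ.toSchwartz ξ‖ ^ 2) + ‖φ‖ ^ 2 / R ^ 2 := by
  have hi := (𝓕 φ.toSchwartz).integrable_norm_sq
  have hm : Integrable fun ξ : Space N => ‖ξ‖ ^ 2 * ‖𝓕 φ.toSchwartz ξ‖ ^ 2 := by
    simp only [EuclideanSpace.real_norm_sq_eq, Finset.sum_mul]
    exact integrable_finsetSum _ fun i _ => φ.integrable_fourier_moment i
  rw [← φ.integral_fourier_sq, ← integral_add_compl measurableSet_ball hi]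
  refine add_le_add_right ?_ _
  rw [le_div_iff₀ (by positivity), ← integral_mul_const]
  calc _ ≤ ∫ ξ in (Metric.ball (0 : Space N) R)ᶜ, ‖ξ‖ ^ 2 * ‖𝓕 φ.toSchwartz ξ‖ ^ 2 := by
        refine setIntegral_mono_on (hi.mul_const _).integrableOn hm.integrableOn
          measurableSet_ball.compl fun ξ hξ => ?_
        rw [mul_comm]
        have : R ≤ ‖ξ‖ := by simpa using hξ
        gcongr
    _ ≤ ∫ ξ, ‖ξ‖ ^ 2 * ‖𝓕 φ.toSchwartz ξ‖ ^ 2 :=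
        setIntegral_le_integral hm (Eventually.of_forall fun ξ => by positivity)
    _ ≤ _ := φ.integral_fourier_moment_le

/-- The splitting into real integrals lets weak convergence in the real space `L²_K` yield pointwise
convergence of the transforms. -/
lemma TestFn.fourier_eq (φ : TestFn N) (ξ : Space N) :
    𝓕 φ.toSchwartz ξ = ((∫ y, Real.cos (-2 * Real.pi * inner ℝ y ξ) * φ.fn y : ℝ) : ℂ)
      + ((∫ y, Real.sin (-2 * Real.pi * inner ℝ y ξ) * φ.fn y : ℝ) : ℂ) * Complex.I := by
  have hb : ∀ {g : Space N → ℝ}, Continuous g → (∀ y, |g y| ≤ 1) →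
      Integrable fun y => g y * φ.fn y := fun {g} hg hg1 =>
    φ.integrable.norm.mono' (hg.mul φ.contDiff.continuous).aestronglyMeasurable
      (Eventually.of_forall fun y => by
        rw [norm_mul]
        exact mul_le_of_le_one_left (norm_nonneg _) (hg1 y))
  rw [SchwartzMap.fourier_coe, Real.fourier_eq', ← integral_complex_ofReal,
    ← integral_complex_ofReal,
    ← integral_mul_const, ← integral_add]
  · refine integral_congr_ae (Eventually.of_forall fun y => ?_)
    simp only [TestFn.toSchwartz_apply, smul_eq_mul, Complex.exp_mul_I]
    push_cast
    ring
  · exact (hb (by fun_prop) fun y => Real.abs_cos_le_one _).ofReal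
  · exact (hb (by fun_prop) fun y => Real.abs_sin_le_one _).ofReal.mul_const _

/-- From `2|φ| ≤ K⁻¹ + K φ²`. The bound is uniform in `ξ` and serves for dominated convergence on
balls. -/
lemma TestFn.norm_fourier_le (φ : TestFn N) (ξ : Space N) :
    ‖𝓕 φ.toSchwartz ξ‖ ≤ (∫ y : Space N, (weight y)⁻¹) + ‖toL2 N φ‖ ^ 2 := by
  rw [SchwartzMap.fourier_coe, Real.fourier_eq', norm_toL2_sq_eq,
    ← integral_add integrable_inv_weight φ.integrable_sq]
  refine norm_integral_le_of_norm_le (integrable_inv_weight.add φ.integrable_sq)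
    (Eventually.of_forall fun y => ?_)
  rw [norm_smul, Complex.norm_exp_ofReal_mul_I, one_mul, TestFn.toSchwartz_apply,
    Complex.norm_real, Real.norm_eq_abs]
  have hw := weight_pos y
  have h : 0 ≤ (weight y)⁻¹ * (1 - weight y * |φ.fn y|) ^ 2 := by positivity
  have e : (weight y)⁻¹ * (1 - weight y * |φ.fn y|) ^ 2
      = (weight y)⁻¹ - 2 * |φ.fn y| + weight y * φ.fn y ^ 2 := by
    rw [← sq_abs (φ.fn y)]
    field_simp
    ring
  have := abs_nonneg (φ.fn y)
  rw [e] at h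
  linarith

variable [Fact (3 ≤ N)]

lemma TestFn.norm_toL2_le (φ : TestFn N) : ‖toL2 N φ‖ ≤ ‖φ‖ := by
  refine le_of_sq_le_sq ?_ (norm_nonneg _)
  have h := φ.poincare
  have h3 := three_le_cast (N := N)
  nlinarith [sq_nonneg ‖toL2 N φ‖]

/-- A bounded sequence of test functions that converges weakly to zero in `L²_K` converges to
zero in the norm of `L²`. -/
lemma TestFn.tendsto_integral_sq {φ : ℕ → TestFn N} {C : ℝ} (hC : ∀ n, ‖φ n‖ ≤ C)
    (h : WeakTendsto (fun n => toL2 N (φ n)) 0) :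
    Tendsto (fun n => ∫ y, (φ n).fn y ^ 2) atTop (𝓝 0) := by
  have hint : ∀ g : Space N → ℝ, Continuous g → (∀ y, |g y| ≤ 1) →
      Tendsto (fun n => ∫ y, g y * (φ n).fn y) atTop (𝓝 0) := by
    intro g hg hg1
    obtain ⟨ℓ, hℓ⟩ := exists_integral_mul_eq_inner hg hg1
    simpa only [hℓ, inner_zero_left] using h ℓ
  have hpt : ∀ ξ, Tendsto (fun n => 𝓕 (φ n).toSchwartz ξ) atTop (𝓝 0) := by
    intro ξ
    have h₁ := hint (fun y => Real.cos (-2 * Real.pi * inner ℝ y ξ)) (by fun_prop)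
      fun y => Real.abs_cos_le_one _
    have h₂ := hint (fun y => Real.sin (-2 * Real.pi * inner ℝ y ξ)) (by fun_prop)
      fun y => Real.abs_sin_le_one _
    simp only [TestFn.fourier_eq]
    have := (Complex.continuous_ofReal.tendsto 0 |>.comp h₁).add
      ((Complex.continuous_ofReal.tendsto 0 |>.comp h₂).mul_const Complex.I)
    simpa using this
  have hC0 : 0 ≤ C := (norm_nonneg _).trans (hC 0)
  have hball : ∀ R : ℝ, Tendsto (fun n => ∫ ξ in Metric.ball (0 : Space N) R,
      ‖𝓕 (φ n).toSchwartz ξ‖ ^ 2) atTop (𝓝 0) := by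
    intro R
    have := tendsto_integral_of_dominated_convergence
      (μ := volume.restrict (Metric.ball (0 : Space N) R))
      (F := fun n ξ => ‖𝓕 (φ n).toSchwartz ξ‖ ^ 2) (f := fun _ => 0)
      (fun _ => ((∫ y : Space N, (weight y)⁻¹) + C ^ 2) ^ 2)
      (fun n => ((𝓕 (φ n).toSchwartz).continuous.norm.pow 2).aestronglyMeasurable)
      (integrable_const_iff.2 (Or.inr ⟨by simp [measure_ball_lt_top]⟩))
      (fun n => Eventually.of_forall fun ξ => by
        rw [norm_pow, norm_norm]
        have h₁ := (φ n).norm_fourier_le ξ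
        have h₂ := (φ n).norm_toL2_le.trans (hC n)
        gcongr
        exact h₁.trans (by gcongr))
      (Eventually.of_forall fun ξ => by simpa using (hpt ξ).norm.pow 2)
    simpa using this
  rw [Metric.tendsto_nhds]
  intro ε hε
  -- This radius makes the high-frequency part `C² / R²` at most `ε / 2`; low frequencies vanish by
  -- `hball`.
  set R : ℝ := √(2 * (C ^ 2 + 1) / ε) with hR
  have hRpos : 0 < R := Real.sqrt_pos.2 (by positivity)
  have hR2 : R ^ 2 = 2 * (C ^ 2 + 1) / ε := Real.sq_sqrt (by positivity)
  filter_upwards [Metric.tendsto_nhds.1 (hball R) (ε / 2) (by positivity)] with n hn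
  rw [Real.dist_0_eq_abs] at hn ⊢
  rw [abs_of_nonneg (integral_nonneg fun y => sq_nonneg _)]
  have h₁ := (φ n).integral_sq_le hRpos
  have h₂ : ‖φ n‖ ^ 2 / R ^ 2 ≤ ε / 2 := by
    rw [hR2, div_le_iff₀ (by positivity)]
    have : ‖φ n‖ ^ 2 ≤ C ^ 2 := by
      have := hC n
      gcongr
    have e : ε / 2 * (2 * (C ^ 2 + 1) / ε) = C ^ 2 + 1 := by field_simp
    linarith
  linarith [le_abs_self (∫ ξ in Metric.ball (0 : Space N) R, ‖𝓕 (φ n).toSchwartz ξ‖ ^ 2)]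

/-- A form of the Rellich theorem: bounded weakly convergent sequences of `X` have subsequences
that converge almost everywhere. -/
lemma exists_subseq_ae_tendsto {u : ℕ → X N} {w : X N} {C : ℝ} (hC : ∀ n, ‖u n‖ ≤ C)
    (h : WeakTendsto u w) : ∃ k : ℕ → ℕ, StrictMono k ∧ ∀ᵐ y ∂(weightMeasure N),
      Tendsto (fun n => emb N (u (k n)) y) atTop (𝓝 (emb N w y)) := by
  -- The Fourier argument is available for test functions, so `u n - w` is replaced by one up to an
  -- error vanishing in `X`.
  have hex : ∀ n, ∃ φ : TestFn N, ‖(u n - w) - (φ : X N)‖ < 1 / ((n : ℝ) + 1) := by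
    intro n
    obtain ⟨φ, hφ⟩ := UniformSpace.Completion.denseRange_coe.exists_dist_lt (u n - w)
      (show (0 : ℝ) < 1 / ((n : ℝ) + 1) by positivity)
    exact ⟨φ, by rwa [← dist_eq_norm]⟩
  choose φ hφ using hex
  have hsmall : Tendsto (fun n => (u n - w) - (φ n : X N)) atTop (𝓝 0) :=
    squeeze_zero_norm (fun n => (hφ n).le) tendsto_one_div_add_atTop_nhds_zero_nat
  have hb : ∀ n, ‖φ n‖ ≤ C + ‖w‖ + 1 := by
    intro n
    have h₁ : (1 : ℝ) / ((n : ℝ) + 1) ≤ 1 := by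
      rw [div_le_one (by positivity)]
      linarith [Nat.cast_nonneg (α := ℝ) n]
    have h₂ := norm_sub_le (u n) w
    have h₃ := norm_sub_norm_le (φ n : X N) (u n - w)
    rw [norm_sub_rev (φ n : X N)] at h₃
    rw [← UniformSpace.Completion.norm_coe]
    linarith [hφ n, hC n]
  have hwk : WeakTendsto (fun n => TestFn.toL2 N (φ n)) 0 := by
    have h₁ : WeakTendsto (fun n => (φ n : X N)) 0 := by
      intro ψ
      have h₂ : Tendsto (fun n => inner ℝ ((u n - w) - (φ n : X N)) ψ) atTop (𝓝 0) := by
        simpa using hsmall.inner (tendsto_const_nhds (x := ψ))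
      have h₃ := ((h ψ).sub_const (inner ℝ w ψ)).sub h₂
      simpa [inner_sub_left] using h₃
    simpa only [emb_coe, map_zero] using h₁.map (emb N)
  have hsq := TestFn.tendsto_integral_sq hb hwk
  have hm₁ : TendstoInMeasure volume (fun n => (φ n).fn) atTop (fun _ : Space N => (0 : ℝ)) := by
    refine tendstoInMeasure_of_tendsto_eLpNorm (p := 2) (by simp)
      (fun n => (φ n).contDiff.continuous.aestronglyMeasurable) aestronglyMeasurable_const ?_
    have hmem : ∀ n, MemLp (φ n).fn 2 (volume : Measure (Space N)) := fun n =>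
      (φ n).contDiff.continuous.memLp_of_hasCompactSupport (φ n).hasCompactSupport
    have e : ∀ n, eLpNorm ((φ n).fn - fun _ => (0 : ℝ)) 2 volume
        = ENNReal.ofReal √(∫ y, (φ n).fn y ^ 2) := by
      intro n
      rw [show ((φ n).fn - fun _ => (0 : ℝ)) = (φ n).fn from sub_zero _,
        (hmem n).eLpNorm_eq_integral_rpow_norm (by simp) (by simp), Real.sqrt_eq_rpow]
      simp
    simp only [e]
    simpa using ENNReal.tendsto_ofReal hsq.sqrt
  -- One extraction makes the test functions tend to zero almost everywhere, a second does so for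
  -- the approximation errors.
  obtain ⟨k₁, hk₁, hae₁⟩ := hm₁.exists_seq_tendsto_ae
  have h₂ : Tendsto (fun n => emb N ((u (k₁ n) - w) - (φ (k₁ n) : X N))) atTop (𝓝 0) := by
    have := ((emb N).continuous.tendsto 0).comp (hsmall.comp hk₁.tendsto_atTop)
    simpa only [map_zero, Function.comp_def] using this
  obtain ⟨k₂, hk₂, hae₂⟩ := (tendstoInMeasure_of_tendsto_Lp h₂).exists_seq_tendsto_ae
  refine ⟨k₁ ∘ k₂, hk₁.comp hk₂, ?_⟩
  have hs₁ : ∀ᵐ y ∂(weightMeasure N), ∀ n, TestFn.toL2 N (φ n) y = (φ n).fn y :=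
    ae_all_iff.2 fun n => (φ n).memLp_fn.coeFn_toLp
  have hs₂ : ∀ᵐ y ∂(weightMeasure N), ∀ n, emb N ((u n - w) - (φ n : X N)) y
      = emb N (u n) y - emb N w y - TestFn.toL2 N (φ n) y := by
    refine ae_all_iff.2 fun n => ?_
    rw [map_sub, map_sub, emb_coe]
    filter_upwards [Lp.coeFn_sub (emb N (u n) - emb N w) (TestFn.toL2 N (φ n)),
      Lp.coeFn_sub (emb N (u n)) (emb N w)] with y h₁ h₂
    rw [h₁, Pi.sub_apply, h₂, Pi.sub_apply]
  filter_upwards [ae_weightMeasure hae₁, hae₂, hs₁, hs₂, Lp.coeFn_zero ℝ 2 (weightMeasure N)]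
    with y h₁ h₂ h₃ h₄ h₅
  rw [h₅] at h₂
  simp only [h₃, h₄] at h₂
  have := (h₂.add (h₁.comp hk₂.tendsto_atTop)).add_const (emb N w y)
  simpa [Function.comp_def] using this

end Rellich

/-! ### Weak sequential continuity of the source term. -/

section Source

variable {N : ℕ} [Fact (3 ≤ N)]

/-- The nonlinearity `t ↦ |t|^(p-1) t`. -/
def critPow (N : ℕ) (t : ℝ) : ℝ := |t| ^ (pExp N - 1) * t

lemma continuous_critPow : Continuous (critPow N) :=
  (continuous_abs.rpow_const fun _ => Or.inr (by linarith [one_lt_pExp (N := N)])).mul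
    continuous_id

lemma abs_critPow (t : ℝ) : |critPow N t| = |t| ^ pExp N := by
  have hp := one_lt_pExp (N := N)
  rw [critPow, abs_mul, abs_of_nonneg (by positivity)]
  rw [← Real.rpow_add_one' (abs_nonneg t) (by linarith), sub_add_cancel]

lemma abs_critPow_le_of_abs_le {s t : ℝ} (h : |s| ≤ |t|) : |critPow N s| ≤ |t| ^ pExp N := by
  have hp := one_lt_pExp (N := N)
  rw [abs_critPow]
  exact Real.rpow_le_rpow (abs_nonneg _) h (by linarith)

/-- A crude Young inequality: replace the smaller of `|s|` and `|t|` by the larger. -/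
lemma abs_critPow_mul_le (s t : ℝ) :
    |critPow N s * t| ≤ |s| ^ (pExp N + 1) + |t| ^ (pExp N + 1) := by
  have hp := one_lt_pExp (N := N)
  have key : ∀ {a b : ℝ}, 0 ≤ a → a ≤ b → a ^ pExp N * b ≤ b ^ (pExp N + 1) := by
    intro a b ha hab
    rw [Real.rpow_add_one' (ha.trans hab) (by linarith)]
    exact mul_le_mul_of_nonneg_right (Real.rpow_le_rpow ha hab (by linarith)) (ha.trans hab)
  rw [abs_mul, abs_critPow]
  have h₁ : 0 ≤ |s| ^ (pExp N + 1) := by positivity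
  have h₂ : 0 ≤ |t| ^ (pExp N + 1) := by positivity
  rcases le_total |s| |t| with h | h
  · linarith [key (abs_nonneg s) h]
  · have h₃ : |s| ^ pExp N * |t| ≤ |s| ^ pExp N * |s| := by gcongr
    rw [← Real.rpow_add_one' (abs_nonneg s) (by linarith)] at h₃
    linarith

lemma aestronglyMeasurable_critPow_emb (u : X N) :
    AEStronglyMeasurable (fun y => critPow N (emb N u y)) (weightMeasure N) :=
  continuous_critPow.comp_aestronglyMeasurable (Lp.aestronglyMeasurable _)

lemma integrable_critPow_mul (u ψ : X N) :
    Integrable (fun y => critPow N (emb N u y) * emb N ψ y) (weightMeasure N) :=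
  ((integrable_emb_critExp u).add (integrable_emb_critExp ψ)).mono'
    ((aestronglyMeasurable_critPow_emb u).mul (Lp.aestronglyMeasurable _))
    (Eventually.of_forall fun _ => abs_critPow_mul_le _ _)

/-- The pairing `(|u|^(p-1) u, ψ)_K`. -/
def critPairing (u ψ : X N) : ℝ :=
  ∫ y, critPow N (emb N u y) * emb N ψ y ∂(weightMeasure N)

/-- The pairing `(|u|^(p-1) u, ·)_K` as a continuous linear functional on `X`. -/
def critFunctional (u : X N) : X N →L[ℝ] ℝ :=
  let L : X N →ₗ[ℝ] ℝ :=
    { toFun := critPairing u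
      map_add' := fun ψ χ => by
        rw [critPairing, critPairing, critPairing,
          ← integral_add (integrable_critPow_mul u ψ) (integrable_critPow_mul u χ), map_add]
        refine integral_congr_ae ?_
        filter_upwards [Lp.coeFn_add (emb N ψ) (emb N χ)] with y hy
        rw [hy, Pi.add_apply, mul_add]
      map_smul' := fun c ψ => by
        rw [critPairing, critPairing, RingHom.id_apply, smul_eq_mul, ← integral_const_mul, map_smul]
        refine integral_congr_ae ?_
        filter_upwards [Lp.coeFn_smul c (emb N ψ)] with y hy
        rw [hy, Pi.smul_apply, smul_eq_mul]
        ring }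
  -- A linear map bounded on the unit ball is continuous, so an inhomogeneous bound is enough; the
  -- divisor 1 is the radius.
  L.mkContinuous ((∫ y, |emb N u y| ^ (pExp N + 1) ∂(weightMeasure N)
      + (sobolevConst N : ℝ) ^ (pExp N + 1)) / 1) <| by
    refine LinearMap.bound_of_ball_bound' one_pos _ L fun ψ hψ => ?_
    have hp := one_lt_pExp (N := N)
    refine (norm_integral_le_of_norm_le ((integrable_emb_critExp u).add (integrable_emb_critExp ψ))
      (Eventually.of_forall fun _ => abs_critPow_mul_le _ _)).trans ?_
    simp only [Pi.add_apply]
    rw [integral_add (integrable_emb_critExp u) (integrable_emb_critExp ψ)]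
    refine add_le_add_right ((integral_emb_critExp_le ψ).trans ?_) _
    refine Real.rpow_le_rpow (by positivity) ?_ (by linarith)
    exact mul_le_of_le_one_right (by positivity) (mem_closedBall_zero_iff.1 hψ)

/-- The singular weight is shared as `(u/|y|)(ψ/|y|)`, so that the Hardy term becomes an inner
product in `L²_K`. -/
lemma sourceMul_ae_eq (μ : ℝ) (u ψ : X N) : sourceMul μ u ψ =ᵐ[weightMeasure N] fun y =>
    critPow N (emb N u y) * emb N ψ y
      + μ * inner ℝ (hardyCLM N u y) (hardyCLM N ψ y)
      + (pExp N - 1)⁻¹ * inner ℝ (emb N u y) (emb N ψ y) := by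
  filter_upwards [coeFn_hardyCLM u, coeFn_hardyCLM ψ] with y h₁ h₂
  rw [h₁, h₂, sourceMul, source, critPow, RCLike.inner_apply, RCLike.inner_apply, conj_trivial,
    conj_trivial]
  ring

lemma integrable_sourceMul (μ : ℝ) (u ψ : X N) :
    Integrable (sourceMul μ u ψ) (weightMeasure N) :=
  (((integrable_critPow_mul u ψ).add ((L2.integrable_inner _ _).const_mul μ)).add
    ((L2.integrable_inner _ _).const_mul _)).congr (sourceMul_ae_eq μ u ψ).symm

lemma sourcePairing_eq (μ : ℝ) (u ψ : X N) : sourcePairing μ u ψ = critFunctional u ψ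
    + μ * inner ℝ (hardyCLM N u) (hardyCLM N ψ)
    + (pExp N - 1)⁻¹ * inner ℝ (emb N u) (emb N ψ) := by
  have i₁ := integrable_critPow_mul u ψ
  have i₂ := (L2.integrable_inner (𝕜 := ℝ) (hardyCLM N u) (hardyCLM N ψ)).const_mul μ
  have i₃ := (L2.integrable_inner (𝕜 := ℝ) (emb N u) (emb N ψ)).const_mul (pExp N - 1)⁻¹
  rw [sourcePairing, integral_congr_ae (sourceMul_ae_eq μ u ψ), integral_add
    (f := fun y => critPow N (emb N u y) * emb N ψ y
      + μ * inner ℝ (hardyCLM N u y) (hardyCLM N ψ y)) (i₁.add i₂) i₃, integral_add i₁ i₂,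
    integral_const_mul, integral_const_mul, L2.inner_def, L2.inner_def]
  rfl

lemma continuous_sourcePairing (μ : ℝ) (u : X N) : Continuous (sourcePairing μ u) := by
  have h : sourcePairing μ u = fun ψ => critFunctional u ψ
    + μ * inner ℝ (hardyCLM N u) (hardyCLM N ψ)
    + (pExp N - 1)⁻¹ * inner ℝ (emb N u) (emb N ψ) := funext fun ψ => sourcePairing_eq μ u ψ
  rw [h]
  fun_prop

/-- Stationary solutions may be tested with test functions only. -/
lemma isStationarySolution_of_testFn {μ : ℝ} {w : X N}
    (h : ∀ φ : TestFn N, inner ℝ w (φ : X N) = sourcePairing μ w φ) :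
    IsStationarySolution μ w := by
  refine fun ψ => ⟨integrable_sourceMul μ w ψ, ?_⟩
  induction ψ using UniformSpace.Completion.induction_on with
  | hp => exact isClosed_eq (by fun_prop) (continuous_sourcePairing μ w)
  | ih φ => exact h φ

/-- Truncation of a real number at height `M`. -/
def truncate (M t : ℝ) : ℝ := max (-M) (min t M)

lemma continuous_truncate (M : ℝ) : Continuous (truncate M) :=
  continuous_const.max (continuous_id.min continuous_const)

lemma abs_truncate_le {M : ℝ} (hM : 0 ≤ M) (t : ℝ) : |truncate M t| ≤ M :=
  abs_le.2 ⟨le_max_left _ _, max_le (by linarith) (min_le_right _ _)⟩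

lemma truncate_eq_self {M t : ℝ} (h : |t| ≤ M) : truncate M t = t := by
  rw [truncate, min_eq_left (abs_le.1 h).2, max_eq_right (abs_le.1 h).1]

/-- The difference is zero unless `|t| > M`, and there `|t|^p ≤ |t|^(p+1) / M`. -/
lemma abs_critPow_sub_truncate_le {M : ℝ} (hM : 0 < M) (t : ℝ) :
    |critPow N t - critPow N (truncate M t)| ≤ 2 / M * |t| ^ (pExp N + 1) := by
  have hp := one_lt_pExp (N := N)
  rcases le_or_gt |t| M with h | h
  · rw [truncate_eq_self h, sub_self, abs_zero]
    positivity
  · have h₁ := abs_critPow_le_of_abs_le (N := N) (le_refl |t|)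
    have h₂ := abs_critPow_le_of_abs_le (N := N) ((abs_truncate_le hM.le t).trans h.le)
    have h₃ : M * |t| ^ pExp N ≤ |t| ^ (pExp N + 1) := by
      rw [Real.rpow_add_one' (abs_nonneg t) (by linarith), mul_comm]
      gcongr
    calc _ ≤ _ := abs_sub _ _
      _ ≤ 2 * |t| ^ pExp N := by linarith
      _ = 2 / M * (M * |t| ^ pExp N) := by field_simp
      _ ≤ _ := by gcongr

lemma integrable_critPow_mul_testFn (u : X N) (φ : TestFn N) :
    Integrable (fun y => critPow N (emb N u y) * φ.fn y) (weightMeasure N) := by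
  refine (integrable_critPow_mul u φ).congr ?_
  rw [emb_coe]
  filter_upwards [φ.memLp_fn.coeFn_toLp] with y hy
  exact congrArg _ hy

lemma critFunctional_testFn (u : X N) (φ : TestFn N) :
    critFunctional u φ = ∫ y, critPow N (emb N u y) * φ.fn y ∂(weightMeasure N) := by
  refine integral_congr_ae ?_
  rw [emb_coe]
  filter_upwards [φ.memLp_fn.coeFn_toLp] with y hy
  exact congrArg _ hy

omit [Fact (3 ≤ N)] in
lemma TestFn.integrable_weightMeasure (φ : TestFn N) : Integrable φ.fn (weightMeasure N) :=
  φ.contDiff.continuous.integrable_of_hasCompactSupport φ.hasCompactSupport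

lemma integrable_critPow_truncate_mul {M : ℝ} (hM : 0 < M) (u : X N) (φ : TestFn N) :
    Integrable (fun y => critPow N (truncate M (emb N u y)) * φ.fn y) (weightMeasure N) := by
  have hp := one_lt_pExp (N := N)
  refine (φ.integrable_weightMeasure.norm.const_mul (M ^ pExp N)).mono'
    (((continuous_critPow.comp (continuous_truncate M)).comp_aestronglyMeasurable
      (Lp.aestronglyMeasurable _)).mul φ.contDiff.continuous.aestronglyMeasurable)
    (Eventually.of_forall fun y => ?_)
  rw [norm_mul, Real.norm_eq_abs, abs_critPow]
  have := abs_truncate_le hM.le (emb N u y)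
  gcongr

lemma abs_critFunctional_sub_le {M B : ℝ} (hM : 0 < M) (u : X N) {φ : TestFn N}
    (hB : ∀ y, |φ.fn y| ≤ B) :
    |critFunctional u φ - ∫ y, critPow N (truncate M (emb N u y)) * φ.fn y ∂(weightMeasure N)|
      ≤ 2 / M * (sobolevConst N * ‖u‖) ^ (pExp N + 1) * B := by
  have hB0 : 0 ≤ B := (abs_nonneg _).trans (hB 0)
  rw [critFunctional_testFn, ← integral_sub (integrable_critPow_mul_testFn u φ)
    (integrable_critPow_truncate_mul hM u φ)]
  rw [← Real.norm_eq_abs]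
  refine (norm_integral_le_of_norm_le
    (g := fun y => 2 / M * |emb N u y| ^ (pExp N + 1) * B)
    (((integrable_emb_critExp u).const_mul _).mul_const _)
    (Eventually.of_forall fun y => ?_)).trans ?_
  · rw [← sub_mul, norm_mul, Real.norm_eq_abs, Real.norm_eq_abs]
    exact mul_le_mul (abs_critPow_sub_truncate_le hM _) (hB y) (abs_nonneg _) (by positivity)
  · rw [integral_mul_const, integral_const_mul]
    have := integral_emb_critExp_le u
    gcongr

/-- Truncated nonlinearities converge by dominated convergence, and the Sobolev bound makes the
truncation error small uniformly in `n`. -/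
lemma tendsto_critFunctional_of_ae {u : ℕ → X N} {w : X N} {C : ℝ} (hC : ∀ n, ‖u n‖ ≤ C)
    (hae : ∀ᵐ y ∂(weightMeasure N), Tendsto (fun n => emb N (u n) y) atTop (𝓝 (emb N w y)))
    (φ : TestFn N) :
    Tendsto (fun n => critFunctional (u n) φ) atTop (𝓝 (critFunctional w φ)) := by
  have hp := one_lt_pExp (N := N)
  obtain ⟨B, hB⟩ : ∃ B, ∀ y, |φ.fn y| ≤ B := by
    obtain ⟨B, hB⟩ := φ.contDiff.continuous.bounded_above_of_compact_support φ.hasCompactSupport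
    exact ⟨B, hB⟩
  have hB0 : 0 ≤ B := (abs_nonneg _).trans (hB 0)
  have hC0 : 0 ≤ C := (norm_nonneg _).trans (hC 0)
  set D : ℝ := (sobolevConst N * (C + ‖w‖)) ^ (pExp N + 1) with hD
  have hD0 : 0 ≤ D := by positivity
  have htr : ∀ {M : ℝ}, 0 < M → Tendsto
      (fun n => ∫ y, critPow N (truncate M (emb N (u n) y)) * φ.fn y ∂(weightMeasure N)) atTop
      (𝓝 (∫ y, critPow N (truncate M (emb N w y)) * φ.fn y ∂(weightMeasure N))) := by
    intro M hM
    refine tendsto_integral_of_dominated_convergence (fun y => M ^ pExp N * ‖φ.fn y‖)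
      (fun n => (integrable_critPow_truncate_mul hM (u n) φ).aestronglyMeasurable)
      (φ.integrable_weightMeasure.norm.const_mul _)
      (fun n => Eventually.of_forall fun y => ?_) ?_
    · rw [norm_mul, Real.norm_eq_abs, abs_critPow]
      have := abs_truncate_le hM.le (emb N (u n) y)
      gcongr
    · filter_upwards [hae] with y hy
      exact (((continuous_critPow.comp (continuous_truncate M)).tendsto _).comp hy).mul_const _
  rw [Metric.tendsto_nhds]
  intro ε hε
  -- Each of the two truncation errors is then at most `ε / 4`. Since `D` is built from `C + ‖w‖`,
  -- one height serves the sequence and the limit.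
  set M : ℝ := 8 * (D * B + 1) / ε with hM
  have hMpos : 0 < M := by positivity
  have hsmall : 2 / M * D * B ≤ ε / 4 := by
    have e : 2 / M * D * B = (D * B) / (D * B + 1) * (ε / 4) := by
      rw [hM]
      field_simp
      ring
    rw [e]
    exact mul_le_of_le_one_left (by positivity) (div_le_one_of_le₀ (by linarith) (by positivity))
  have hbound : ∀ x : X N, ‖x‖ ≤ C + ‖w‖ → |critFunctional x φ
      - ∫ y, critPow N (truncate M (emb N x y)) * φ.fn y ∂(weightMeasure N)| ≤ ε / 4 := by
    intro x hx
    refine (abs_critFunctional_sub_le hMpos x hB).trans (le_trans ?_ hsmall)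
    rw [hD]
    gcongr
  filter_upwards [Metric.tendsto_nhds.1 (htr hMpos) (ε / 4) (by positivity)] with n hn
  have h₁ := hbound (u n) ((hC n).trans (by linarith [norm_nonneg w]))
  have h₂ := hbound w (by linarith)
  rw [Real.dist_eq] at hn ⊢
  rw [abs_le] at h₁ h₂
  rw [abs_lt] at hn ⊢
  constructor <;> linarith

/-- For a fixed test function the source pairing is weakly sequentially continuous. -/
lemma tendsto_sourcePairing {u : ℕ → X N} {w : X N} {C : ℝ} (hC : ∀ n, ‖u n‖ ≤ C)
    (h : WeakTendsto u w) (μ : ℝ) (φ : TestFn N) :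
    Tendsto (fun n => sourcePairing μ (u n) φ) atTop (𝓝 (sourcePairing μ w φ)) := by
  have h₁ : Tendsto (fun n => critFunctional (u n) φ) atTop (𝓝 (critFunctional w φ)) := by
    -- Almost everywhere convergence holds only along subsequences, but the limit of the functional
    -- is always the same.
    refine tendsto_of_subseq_tendsto fun k hk => ?_
    obtain ⟨j, hj, hae⟩ := exists_subseq_ae_tendsto (fun n => hC (k n)) (h.comp hk)
    exact ⟨j, tendsto_critFunctional_of_ae (fun n => hC (k (j n))) hae φ⟩
  simp only [sourcePairing_eq]
  exact (h₁.add ((h.map (hardyCLM N) _).const_mul μ)).add ((h.map (emb N) _).const_mul _)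

end Source

/-! ### Bounded trajectories: decay of the time derivative and of the residual. -/

section Trajectories

section Tail

variable {E : Type*} [NormedAddCommGroup E] {g : ℝ → E}

lemma intervalIntegrable_of_memLp_two (hg : MemLp g 2 (volume.restrict (Set.Ioi 0))) {a b : ℝ}
    (ha : 0 ≤ a) (hb : 0 ≤ b) : IntervalIntegrable g volume a b := by
  rw [intervalIntegrable_iff]
  have h : Set.uIoc a b ⊆ Set.Ioi 0 := fun x hx => (le_min ha hb).trans_lt hx.1
  have : IsFiniteMeasure (volume.restrict (Set.uIoc a b)) :=
    ⟨by rw [Measure.restrict_apply_univ, Set.uIoc, Real.volume_Ioc]; exact ENNReal.ofReal_lt_top⟩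
  exact (hg.mono_measure (Measure.restrict_mono h le_rfl)).integrable one_le_two

/-- The integrals of a function of `L²(0, ∞)` over intervals of unit length vanish at infinity. -/
lemma tendsto_integral_norm_unit_interval (hg : MemLp g 2 (volume.restrict (Set.Ioi 0))) :
    Tendsto (fun a : ℝ => ∫ τ in a..a + 1, ‖g τ‖) atTop (𝓝 0) := by
  have hsq : IntegrableOn (fun τ => ‖g τ‖ ^ 2) (Set.Ioi 0) :=
    hg.integrable_norm_pow (by norm_num)
  have hsi : ∀ {a b : ℝ}, 0 ≤ a → 0 ≤ b →
      IntervalIntegrable (fun τ => ‖g τ‖ ^ 2) volume a b := fun {a b} ha hb => by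
    rw [intervalIntegrable_iff]
    exact hsq.mono_set fun x hx => (le_min ha hb).trans_lt hx.1
  have hlim : Tendsto (fun a : ℝ => ∫ τ in a..a + 1, ‖g τ‖ ^ 2) atTop (𝓝 0) := by
    have h₁ := intervalIntegral_tendsto_integral_Ioi 0 hsq tendsto_id
    have h₂ := intervalIntegral_tendsto_integral_Ioi 0 hsq
      (tendsto_atTop_add_const_right atTop (1 : ℝ) tendsto_id)
    have h₃ := h₂.sub h₁
    rw [sub_self] at h₃
    refine h₃.congr' ?_
    filter_upwards [eventually_ge_atTop 0] with a ha
    exact intervalIntegral.integral_interval_sub_left (hsi le_rfl (by simp only [id]; linarith))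
      (hsi le_rfl ha)
  rw [Metric.tendsto_nhds]
  intro ε hε
  filter_upwards [eventually_ge_atTop 0,
    Metric.tendsto_nhds.1 hlim (ε ^ 2) (by positivity)] with a ha h
  have ha1 : a ≤ a + 1 := by linarith
  rw [Real.dist_0_eq_abs] at h ⊢
  rw [abs_of_nonneg (intervalIntegral.integral_nonneg ha1 fun _ _ => norm_nonneg _)]
  have hI := hsi ha (ha.trans ha1)
  -- Young's inequality with parameter `ε`; together with `∫ ‖g‖² < ε²` on a unit interval it gives
  -- a total below `ε`.
  have h₁ : ∫ τ in a..a + 1, ‖g τ‖ ≤ ∫ τ in a..a + 1, (ε / 2 + (2 * ε)⁻¹ * ‖g τ‖ ^ 2) := by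
    refine intervalIntegral.integral_mono_on ha1
      (intervalIntegrable_of_memLp_two hg ha (ha.trans ha1)).norm
      (intervalIntegrable_const.add (hI.const_mul _)) fun τ _ => ?_
    have h₂ : 0 ≤ (2 * ε)⁻¹ * (‖g τ‖ - ε) ^ 2 := by positivity
    have h₃ : (2 * ε)⁻¹ * (‖g τ‖ - ε) ^ 2 = ε / 2 + (2 * ε)⁻¹ * ‖g τ‖ ^ 2 - ‖g τ‖ := by
      field_simp
      ring
    linarith
  rw [intervalIntegral.integral_add intervalIntegrable_const (hI.const_mul _),
    intervalIntegral.integral_const_mul, intervalIntegral.integral_const] at h₁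
  have h₂ : (2 * ε)⁻¹ * ∫ τ in a..a + 1, ‖g τ‖ ^ 2 < (2 * ε)⁻¹ * ε ^ 2 := by
    have := (le_abs_self _).trans_lt h
    gcongr
  have h₃ : (2 * ε)⁻¹ * ε ^ 2 = ε / 2 := by field_simp
  simp only [add_sub_cancel_left, one_smul] at h₁
  linarith

end Tail

variable {N : ℕ} [Fact (3 ≤ N)]

lemma timeInterval_top : timeInterval ⊤ = Set.Ioi 0 := by
  ext s
  simp [timeInterval, EReal.coe_lt_top]

section Evolution

variable {μ : ℝ} {v₀ : X N} {v : ℝ → X N} {g : ℝ → L2K N}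

lemma emb_sub_emb_eq_integral (hg : MemLp g 2 (volume.restrict (Set.Ioi 0)))
    (hvg : ∀ s, 0 ≤ s → emb N (v s) = emb N v₀ + ∫ τ in (0 : ℝ)..s, g τ) {a b : ℝ}
    (ha : 0 ≤ a) (hb : 0 ≤ b) : emb N (v b) - emb N (v a) = ∫ τ in a..b, g τ := by
  rw [hvg a ha, hvg b hb, add_sub_add_left_eq_sub]
  exact intervalIntegral.integral_interval_sub_left
    (intervalIntegrable_of_memLp_two hg le_rfl hb) (intervalIntegrable_of_memLp_two hg le_rfl ha)

lemma continuousOn_emb (hg : MemLp g 2 (volume.restrict (Set.Ioi 0)))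
    (hvg : ∀ s, 0 ≤ s → emb N (v s) = emb N v₀ + ∫ τ in (0 : ℝ)..s, g τ) :
    ContinuousOn (fun τ => emb N (v τ)) (Set.Ici 0) := by
  intro s hs
  have hs0 : (0 : ℝ) ≤ s := hs
  have h := intervalIntegral.continuousOn_primitive_interval'
    (intervalIntegrable_of_memLp_two hg le_rfl (by linarith : (0 : ℝ) ≤ s + 1)) Set.left_mem_uIcc
  rw [Set.uIcc_of_le (by linarith)] at h
  have h' : ContinuousOn (fun τ => emb N (v τ)) (Set.Icc 0 (s + 1)) :=
    (continuousOn_const.add h).congr fun τ hτ => hvg τ hτ.1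
  refine (h' s ⟨hs0, by linarith⟩).mono_of_mem_nhdsWithin ?_
  exact inter_mem_nhdsWithin _ (Iic_mem_nhds (lt_add_one s))

lemma weakTendsto_of_tendsto {E : Type*} [NormedAddCommGroup E] [InnerProductSpace ℝ E]
    {u : ℕ → E} {w : E} (h : Tendsto u atTop (𝓝 w)) : WeakTendsto u w :=
  fun _ => h.inner tendsto_const_nhds

variable {C : ℝ}

/-- The residual of the stationary equation along a bounded trajectory is continuous in time. -/
lemma continuousOn_residual (hc : ContinuousOn (fun τ => emb N (v τ)) (Set.Ici 0))
    (hC : ∀ s : ℝ, 0 ≤ s → ‖v s‖ ≤ C) (μ : ℝ) (φ : TestFn N) :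
    ContinuousOn (fun τ => sourcePairing μ (v τ) φ) (Set.Ici 0) ∧
      ContinuousOn (fun τ => inner ℝ (v τ) (φ : X N)) (Set.Ici 0) := by
  rw [continuousOn_iff_continuous_domRestrict] at hc
  -- Continuity in `L²_K` and boundedness in `X` give weak continuity in `X`.
  have hwk : ∀ (x : ℕ → Set.Ici (0 : ℝ)) (a : Set.Ici (0 : ℝ)), Tendsto x atTop (𝓝 a) →
      WeakTendsto (fun n => v (x n)) (v a) := fun x a hx =>
    weakTendsto_of_emb (Eventually.of_forall fun n => hC _ (x n).2)
      (weakTendsto_of_tendsto ((hc.tendsto a).comp hx))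
  constructor <;> rw [continuousOn_iff_continuous_domRestrict, continuous_iff_seqContinuous] <;>
    intro x a hx
  · exact tendsto_sourcePairing (fun n => hC _ (x n).2) (hwk x a hx) μ φ
  · exact hwk x a hx φ

/-- On every unit time interval the residual of the stationary equation takes a value
controlled by the time derivative. -/
lemma exists_abs_residual_le (hg : MemLp g 2 (volume.restrict (Set.Ioi 0)))
    (hvg : ∀ s, 0 ≤ s → emb N (v s) = emb N v₀ + ∫ τ in (0 : ℝ)..s, g τ)
    (hC : ∀ s : ℝ, 0 ≤ s → ‖v s‖ ≤ C) (φ : TestFn N)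
    (heq : ∀ s : ℝ, 0 < s →
      ∫ τ in (0 : ℝ)..s, (inner ℝ (g τ) (emb N (φ : X N)) + inner ℝ (v τ) (φ : X N))
        = ∫ τ in (0 : ℝ)..s, sourcePairing μ (v τ) φ) {a : ℝ} (ha : 0 < a) :
    ∃ t ∈ Set.Ioc a (a + 1), |sourcePairing μ (v t) φ - inner ℝ (v t) (φ : X N)|
      ≤ ‖emb N (φ : X N)‖ * ∫ τ in a..a + 1, ‖g τ‖ := by
  obtain ⟨hc₁, hc₂⟩ := continuousOn_residual (continuousOn_emb hg hvg) hC μ φ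
  have hi : ∀ {f : ℝ → ℝ}, ContinuousOn f (Set.Ici 0) → ∀ {b c : ℝ}, 0 ≤ b → 0 ≤ c →
      IntervalIntegrable f volume b c := fun hf b c hb hc =>
    (hf.mono fun x hx => (le_min hb hc).trans hx.1).intervalIntegrable
  have hig : ∀ {b c : ℝ}, 0 ≤ b → 0 ≤ c →
      IntervalIntegrable (fun τ => inner ℝ (g τ) (emb N (φ : X N))) volume b c := by
    intro b c hb hc
    have := intervalIntegrable_of_memLp_two hg hb hc
    rw [intervalIntegrable_iff] at this ⊢
    exact this.inner_const _
  have ha1 : 0 < a + 1 := by linarith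
  have hdiff : ∫ τ in a..a + 1, (sourcePairing μ (v τ) φ - inner ℝ (v τ) (φ : X N))
      = ∫ τ in a..a + 1, inner ℝ (g τ) (emb N (φ : X N)) := by
    -- The weak form is given on `(0, s)`; subtracting two instances localises it to `(a, a + 1)`.
    have h₁ := congrArg₂ HSub.hSub (heq (a + 1) ha1) (heq a ha)
    rw [intervalIntegral.integral_interval_sub_left ((hig le_rfl ha1.le).add (hi hc₂ le_rfl ha1.le))
      ((hig le_rfl ha.le).add (hi hc₂ le_rfl ha.le)),
      intervalIntegral.integral_interval_sub_left (hi hc₁ le_rfl ha1.le) (hi hc₁ le_rfl ha.le),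
      intervalIntegral.integral_add (hig ha.le ha1.le) (hi hc₂ ha.le ha1.le)] at h₁
    rw [intervalIntegral.integral_sub (hi hc₁ ha.le ha1.le) (hi hc₂ ha.le ha1.le), ← h₁]
    ring
  have hle : a ≤ a + 1 := by linarith
  -- Mean value theorem for integrals; on an interval of length one the average is the integral.
  obtain ⟨t, ht, hF⟩ := exists_eq_interval_average
    (f := fun τ => sourcePairing μ (v τ) φ - inner ℝ (v τ) (φ : X N)) (show a ≠ a + 1 by linarith)
    ((hc₁.sub hc₂).mono fun x hx => (le_min ha.le ha1.le).trans hx.1)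
  rw [Set.uIoo_of_le hle] at ht
  refine ⟨t, ⟨ht.1, ht.2.le⟩, ?_⟩
  rw [interval_average_eq] at hF
  simp only [add_sub_cancel_left, inv_one, one_smul] at hF
  rw [hF, hdiff, ← intervalIntegral.integral_const_mul, ← Real.norm_eq_abs]
  refine intervalIntegral.norm_integral_le_of_norm_le hle (Eventually.of_forall fun τ _ => ?_)
    ((intervalIntegrable_of_memLp_two hg ha.le ha1.le).norm.const_mul _)
  rw [mul_comm]
  exact norm_inner_le_norm _ _

end Evolution

end Trajectories

end HardySobolev

end

/-! ### The convergence theorem. -/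

theorem theorem6p1 (N : ℕ) [Fact (3 ≤ N)] (μ : ℝ) (hμ₀ : 0 ≤ μ)
    (hμ : μ ≤ ((N : ℝ) - 2) ^ 2 / 8)
    (v₀ : X N) (v : ℝ → X N) (hv : IsGlobalSolution μ v₀ v)
    (hbdd : ∃ C : ℝ, ∀ s : ℝ, 0 ≤ s → ‖v s‖ ≤ C)
    (s : ℕ → ℝ) (hs : Tendsto s atTop atTop) :
    ∃ (k : ℕ → ℕ) (w : X N), StrictMono k ∧ IsStationarySolution μ w ∧
      Tendsto (fun n => toWeakSpace ℝ (X N) (v (s (k n)))) atTop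
        (𝓝 (toWeakSpace ℝ (X N) w)) := by
  obtain ⟨C, hC⟩ := hbdd
  obtain ⟨g, hg, hvg, heq⟩ := hv.exists_deriv
  rw [timeInterval_top] at hg hvg heq
  have hvg' : ∀ s, 0 ≤ s → emb N (v s) = emb N v₀ + ∫ τ in (0 : ℝ)..s, g τ := by
    intro s hs
    rcases hs.eq_or_lt with rfl | hs
    · simp [hv.initial]
    · exact hvg s hs
  -- The bound on `v` concerns nonnegative times, so the first terms of the sequence are discarded.
  obtain ⟨n₀, hn₀⟩ := eventually_atTop.1 (hs.eventually_gt_atTop 0)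
  have hpos : ∀ n, 0 < s (n + n₀) := fun n => hn₀ _ (Nat.le_add_left _ _)
  obtain ⟨k, w, hk, hw⟩ := exists_weakTendsto_subseq (u := fun n => v (s (n + n₀)))
    fun n => hC _ (hpos n).le
  have hs' : Tendsto (fun n => s (k n + n₀)) atTop atTop :=
    hs.comp (tendsto_atTop_mono (fun n => Nat.le_add_right _ _) hk.tendsto_atTop)
  refine ⟨fun n => k n + n₀, w, fun a b hab => Nat.add_lt_add_right (hk hab) _,
    isStationarySolution_of_testFn fun φ => ?_, hw.toWeakSpace⟩
  have htail := (tendsto_integral_norm_unit_interval hg).comp hs'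
  -- The times `t n` depend on `φ`. This is harmless, since `w` and the subsequence are fixed
  -- beforehand.
  choose t ht hres using fun n => exists_abs_residual_le (μ := μ) hg hvg' hC φ
    (fun s hs => heq φ s hs) (hpos (k n))
  have ht0 : ∀ n, 0 ≤ t n := fun n => ((hpos (k n)).trans (ht n).1).le
  have hclose : Tendsto (fun n => emb N (v (t n)) - emb N (v (s (k n + n₀)))) atTop (𝓝 0) := by
    refine squeeze_zero_norm (fun n => ?_) htail
    have h₁ : s (k n + n₀) ≤ s (k n + n₀) + 1 := by linarith
    rw [emb_sub_emb_eq_integral hg hvg' (hpos (k n)).le (ht0 n)]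
    refine (intervalIntegral.norm_integral_le_integral_norm (ht n).1.le).trans ?_
    exact intervalIntegral.integral_mono_interval le_rfl (ht n).1.le (ht n).2
      (Eventually.of_forall fun _ => norm_nonneg _)
      (intervalIntegrable_of_memLp_two hg (hpos (k n)).le ((hpos (k n)).le.trans h₁)).norm
  -- By `hclose` the shifted times give the same weak limit in `L²_K`, and boundedness in `X` lifts
  -- it back to `X`.
  have hwt : WeakTendsto (fun n => v (t n)) w := by
    refine weakTendsto_of_emb (C := C) (Eventually.of_forall fun n => hC _ (ht0 n)) fun ψ => ?_
    have h₁ := (hw.map (emb N) ψ).add (hclose.inner (tendsto_const_nhds (x := ψ)))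
    simpa [inner_sub_left] using h₁
  have hlim : Tendsto (fun n => sourcePairing μ (v (t n)) φ - inner ℝ (v (t n)) (φ : X N)) atTop
      (𝓝 (sourcePairing μ w φ - inner ℝ w (φ : X N))) :=
    (tendsto_sourcePairing (fun n => hC _ (ht0 n)) hwt μ φ).sub (hwt φ)
  have hzero : Tendsto (fun n => sourcePairing μ (v (t n)) φ - inner ℝ (v (t n)) (φ : X N)) atTop
      (𝓝 0) :=
    squeeze_zero_norm hres (by simpa using htail.const_mul ‖emb N (φ : X N)‖)
  linarith [tendsto_nhds_unique hlim hzero]
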